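/- Let $d\ge 1$, $m\ge 0$ be integers, let $\mathbb{M}$ be the space of real $m\times d$ matrices with the Frobenius inner product $(A,B)=\operatorname{Tr}(AB^{T})$, and let $B$ be the open unit ball of $\mathbb{R}^d$. Let $W:\mathbb{M}\to\mathbb{R}$ be continuous and bounded below, and let $F_+,F_-\in\mathbb{M}$ be such that $W$ is of class $C^2$ in a neighborhood of $\{F_+,F_-\}$. Write $[[X]]=X_+-X_-$, and assume that $[[F]]=F_+-F_-=a\otimes n$ for some $a\in\mathbb{R}^m$ and some unit vector $n\in\mathbb{R}^d$. Let $W_F(F)\in\mathbb{M}$ denote the matrix of partial derivatives $\partial W/\partial F_{ij}$ and put $[[W_F]]=W_F(F_+)-W_F(F_-)$. A Borel measurable, locally bounded function $g:\mathbb{M}\to\mathbb{R}$ is quasiconvex if $g(F)\le \frac{1}{|B|}\int_B g(F+\nabla\phi)\,dz$ for all $F\in\mathbb{M}$ and all $\phi\in W^{1,\infty}_0(B;\mathbb{R}^m)$; let $QW$ be the quasiconvex envelope of $W$, i.e. the largest quasiconvex function not exceeding $W$. The interface $\Pi_n=\{z\in\mathbb{R}^d: z\cdot n=0\}$ determined by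 $F_\pm$ is called strongly locally stable if, with $B_n^{\pm}=\{z\in B:\pm z\cdot n>0\}$, $$\frac{1}{|B_n^+|}\int_{B_n^+}W(F_++\nabla\phi)\,dz+\frac{1}{|B_n^-|}\int_{B_n^-}W(F_-+\nabla\phi)\,dz\ \ge\ W(F_+)+W(F_-)\qquad\text{for all }\phi\in C_0^\infty(B;\mathbb{R}^m).\tag{1}$$ In terms of global minimality, strong local stability is expressed as follows: the Lipschitz map $\bar y$ with $\bar y(z)=F_+z$ for $z\cdot n>0$ and $\bar y(z)=F_-z$ for $z\cdot n\le 0$ satisfies $$\int_B W(\nabla \bar y)\,dz\ \le\ \int_B W(\nabla y)\,dz\qquad\text{for all } y\in W^{1,\infty}(B;\mathbb{R}^m)\text{ with } y=\bar y\text{ on }\partial B.\tag{2}$$ Then each of the two formulations (1) and (2) of strong local stability holds if and only if the following two conditions are both satisfied: (S) (material stability in the bulk) $QW(F_+)=W(F_+)$ and $QW(F_-)=W(F_-)$; (I) (interchange stability) $\mathfrak{N}=([[W_F]],[[F]])\le 0$. -/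

import Mathlib

open MeasureTheory Set

noncomputable section

namespace PhaseInterface

/-- Euclidean space `ℝ^k`. -/
abbrev Vec (k : ℕ) : Type := EuclideanSpace ℝ (Fin k)

/-- The space `𝕄` of real `m × d` matrices, viewed as the linear maps `ℝ^d → ℝ^m`, so that the
gradient of a map `y : ℝ^d → ℝ^m` at `z` is `fderiv ℝ y z`. -/
abbrev Mat (d m : ℕ) : Type := Vec d →L[ℝ] Vec m

/-- The tensor product `a ⊗ n = a nᵀ`, i.e. `z ↦ (z · n) a`. -/
def tensor {d m : ℕ} (a : Vec m) (n : Vec d) : Mat d m :=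
  InnerProductSpace.rankOne ℝ a n

/-- The matrix unit `e_i ⊗ e_j`. -/
def matUnit {d m : ℕ} (i : Fin m) (j : Fin d) : Mat d m :=
  tensor (EuclideanSpace.single i (1 : ℝ)) (EuclideanSpace.single j (1 : ℝ))

/-- The entry `F_ij`. -/
def entry {d m : ℕ} (F : Mat d m) (i : Fin m) (j : Fin d) : ℝ :=
  F (EuclideanSpace.single j (1 : ℝ)) i

/-- The Frobenius inner product `(A, B) = ∑_ij A_ij B_ij = Tr (A Bᵀ)`. -/
def frobeniusInner {d m : ℕ} (A B : Mat d m) : ℝ :=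
  ∑ i, ∑ j, entry A i j * entry B i j

/-- The matrix `W_F(F)` of partial derivatives `∂W/∂F_ij` at `F`. -/
def matGrad {d m : ℕ} (W : Mat d m → ℝ) (F : Mat d m) : Mat d m :=
  ∑ i, ∑ j, (fderiv ℝ W F (matUnit i j)) • matUnit i j

/-- The interchange driving force `𝔑 = (⟦W_F⟧, ⟦F⟧)`, where `⟦X⟧ = X₊ - X₋`. -/
def interchangeForce {d m : ℕ} (W : Mat d m → ℝ) (Fp Fm : Mat d m) : ℝ :=
  frobeniusInner (matGrad W Fp - matGrad W Fm) (Fp - Fm)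

/-- The open unit ball `B` of `ℝ^d`. -/
def unitBall (d : ℕ) : Set (Vec d) := Metric.ball 0 1

/-- The half ball `{z ∈ B : z · n > 0}`. -/
def halfBallPos {d : ℕ} (n : Vec d) : Set (Vec d) := {z ∈ unitBall d | 0 < inner ℝ z n}

/-- The half ball `{z ∈ B : z · n < 0}`. -/
def halfBallNeg {d : ℕ} (n : Vec d) : Set (Vec d) := {z ∈ unitBall d | inner ℝ z n < 0}

/-- The maps in `W^{1,∞}(B; ℝ^m)`, that is, Lipschitz maps on the closed unit ball, whose values
on `∂B` are those of `u`. Only the values on the closed ball matter. -/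
def lipschitzClass {d m : ℕ} (u : Vec d → Vec m) : Set (Vec d → Vec m) :=
  {y | (∃ K : NNReal, LipschitzOnWith K y (Metric.closedBall 0 1)) ∧
    ∀ z ∈ Metric.sphere (0 : Vec d) 1, y z = u z}

/-- Quasiconvexity of a Borel measurable, locally bounded function on matrices:
`g(F) ≤ ⨍_B g(F + ∇φ)` for all `F` and all `φ ∈ W₀^{1,∞}(B; ℝ^m)`. -/
structure IsQuasiconvex {d m : ℕ} (g : Mat d m → ℝ) : Prop where
  measurable : Measurable g
  locallyBounded : ∀ R : ℝ, ∃ C : ℝ, ∀ F : Mat d m, ‖F‖ ≤ R → |g F| ≤ C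
  le_average : ∀ (F : Mat d m), ∀ φ ∈ lipschitzClass (fun _ : Vec d => (0 : Vec m)),
    g F ≤ ⨍ z in unitBall d, g (F + fderiv ℝ φ z)

/-- The quasiconvex envelope `QW`, the largest quasiconvex function that does not exceed `W`. -/
def quasiconvexEnvelope {d m : ℕ} (W : Mat d m → ℝ) (F : Mat d m) : ℝ :=
  sSup {r : ℝ | ∃ g : Mat d m → ℝ, IsQuasiconvex g ∧ (∀ G, g G ≤ W G) ∧ g F = r}

/-- The test functions `C₀^∞(B; ℝ^m)`: smooth, with compact support in the open unit ball. -/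
def IsTestFunction {d m : ℕ} (φ : Vec d → Vec m) : Prop :=
  ContDiff ℝ (⊤ : ℕ∞) φ ∧ tsupport φ ⊆ unitBall d

/-- Strong local stability of the interface `{z : z · n = 0}` determined by `F₊` and `F₋`, as an
inequality for smooth variations. -/
def IsStronglyLocallyStable {d m : ℕ} (W : Mat d m → ℝ) (Fp Fm : Mat d m) (n : Vec d) : Prop :=
  ∀ φ : Vec d → Vec m, IsTestFunction φ →
    W Fp + W Fm ≤ (⨍ z in halfBallPos n, W (Fp + fderiv ℝ φ z)) +
      ⨍ z in halfBallNeg n, W (Fm + fderiv ℝ φ z)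

/-- The piecewise affine map `ȳ` with `ȳ(z) = F₊ z` if `z · n > 0` and `ȳ(z) = F₋ z` if
`z · n < 0` (the two agree on `z · n = 0` when `F₊ - F₋ = a ⊗ n`). -/
def piecewiseAffine {d m : ℕ} (Fp Fm : Mat d m) (n : Vec d) (z : Vec d) : Vec m :=
  if 0 < inner ℝ z n then Fp z else Fm z

/-- The energy `∫_B W(∇y)`. -/
def energy {d m : ℕ} (W : Mat d m → ℝ) (y : Vec d → Vec m) : ℝ :=
  ∫ z in unitBall d, W (fderiv ℝ y z)

/-- Strong local stability of the interface as global minimality: `ȳ` is Lipschitz and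
minimizes `∫_B W(∇y)` among all Lipschitz maps `y` on the ball with `y = ȳ` on `∂B`. -/
def IsInterfaceMinimizer {d m : ℕ} (W : Mat d m → ℝ) (Fp Fm : Mat d m) (n : Vec d) : Prop :=
  piecewiseAffine Fp Fm n ∈ lipschitzClass (piecewiseAffine Fp Fm n) ∧
    IsMinOn (energy W) (lipschitzClass (piecewiseAffine Fp Fm n)) (piecewiseAffine Fp Fm n)

end PhaseInterface

end

noncomputable section

namespace PhaseInterface

open Metric Filter Topology

variable {d m : ℕ}

/-! Write ȳ for the broken affine map, P and Q for the derivatives of W at F₊ and F₋, and F̄ = (F₊ +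
F₋)/2. Both formulations of stability are reduced to `IsStableUnderVariations`: adding a Lipschitz
map that vanishes off the unit ball does not lower the energy of ȳ. For minimality this is extension
by zero (`isInterfaceMinimizer_iff`). For smooth test functions, ȳ is positively homogeneous of
degree one, so a variation can be shrunk to the concentric ball of radius 1/2 and then mollified
there (`isStronglyLocallyStable_iff_isStableUnderVariations`).

The condition QW(F) = W(F) is turned into the quasiconvexity inequality for W at the single matrix
F. The link is the relaxation Z = `relaxation W` of Dacorogna's formula, which is quasiconvex and
lies below W (`isQuasiconvexAt_relaxation`, `quasiconvexEnvelope_eq_iff`).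

Sufficiency. The laminate with mean gradient F̄ and gradients F₊, F₋ in alternating layers contains
many translated copies of ȳ. Inserting a variation φ into a positive fraction of the volume and
testing quasiconvexity of Z at F̄ gives Z(F̄) ≤ (Z(F₊) + Z(F₋))/2 + cΔ with c > 0, where Δ is the
change in Z-energy that φ causes at one interface (`IsQuasiconvexAt.le_laminate`). Since Z is convex
along rank-one lines at dyadic points and touches W at F₊ and F₋, it lies above the tangents of W
there (`tangent_le_of_quasiconvexAt`). Averaging the two tangents at F̄ gives Z(F̄) ≥ (W(F₊) +
W(F₋))/2 − (P − Q)(a ⊗ n)/4. If 𝔑 = (P − Q)(a ⊗ n) ≤ 0, then Δ ≥ 0, and Z ≤ W with equality at F₊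
and F₋ transfers this to W (`energy_piecewiseAffine_le`).

Necessity. Variations supported in a ball on one side of the interface give quasiconvexity at F₊ and
F₋. The first variation of the energy in the direction (1 − |x|²)a is a negative multiple of 𝔑,
which gives 𝔑 ≤ 0 (`IsStableUnderVariations.interchange_le`). -/

/-! ### Lipschitz variations and extension by zero. -/

/-- Lipschitz variations vanishing outside `s`. -/
def IsVariation (s : Set (Vec d)) (φ : Vec d → Vec m) : Prop :=
  (∃ K : NNReal, LipschitzWith K φ) ∧ ∀ z ∉ s, φ z = 0

/-- Boundedness on bounded sets of matrices. -/
def IsBoundedOnBounded (g : Mat d m → ℝ) : Prop :=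
  ∀ R : ℝ, ∃ C : ℝ, ∀ F : Mat d m, ‖F‖ ≤ R → |g F| ≤ C

/-- Quasiconvexity at a single matrix, with globally defined variations. -/
def IsQuasiconvexAt (g : Mat d m → ℝ) (F : Mat d m) : Prop :=
  ∀ φ : Vec d → Vec m, IsVariation (ball 0 1) φ →
    g F * volume.real (ball (0 : Vec d) 1) ≤
      ∫ z in ball (0 : Vec d) 1, g (fderiv ℝ (fun x => F x + φ x) z)

theorem IsVariation.zero (s : Set (Vec d)) : IsVariation s (fun _ => (0 : Vec m)) :=
  ⟨⟨0, LipschitzWith.const 0⟩, fun _ _ => rfl⟩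

theorem IsVariation.mono {s t : Set (Vec d)} {φ : Vec d → Vec m} (h : IsVariation s φ)
    (hst : s ⊆ t) : IsVariation t φ :=
  ⟨h.1, fun z hz => h.2 z fun hs => hz (hst hs)⟩

theorem IsVariation.add {s : Set (Vec d)} {φ ψ : Vec d → Vec m} (hφ : IsVariation s φ)
    (hψ : IsVariation s ψ) : IsVariation s (fun x => φ x + ψ x) := by
  obtain ⟨⟨K, hK⟩, h0⟩ := hφ
  obtain ⟨⟨L, hL⟩, h1⟩ := hψ
  exact ⟨⟨K + L, hK.add hL⟩, fun z hz => by simp [h0 z hz, h1 z hz]⟩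

theorem IsVariation.sum {ι : Type*} {s : Set (Vec d)} (t : Finset ι) {w : ι → Vec d → Vec m}
    (hw : ∀ i ∈ t, IsVariation s (w i)) : IsVariation s (fun x => ∑ i ∈ t, w i x) := by
  classical
  induction t using Finset.induction_on with
  | empty => simpa using IsVariation.zero s
  | insert i t hi ih =>
    simp only [Finset.sum_insert hi]
    exact (hw i (by simp)).add (ih fun j hj => hw j (by simp [hj]))

theorem IsVariation.lipschitz_add {s : Set (Vec d)} {u φ : Vec d → Vec m}
    (hu : ∃ K, LipschitzWith K u) (hφ : IsVariation s φ) :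
    ∃ K, LipschitzWith K (fun x => u x + φ x) := by
  obtain ⟨⟨K, hK⟩, -⟩ := hφ
  obtain ⟨L, hL⟩ := hu
  exact ⟨L + K, hL.add hK⟩

theorem lipschitz_clm (F : Mat d m) : ∃ K, LipschitzWith K (fun x => F x) :=
  ⟨_, F.lipschitz⟩

/-- Rescaling of a variation of the unit ball to `ball c r`. -/
theorem IsVariation.rescale {φ : Vec d → Vec m} (hφ : IsVariation (ball 0 1) φ) (c : Vec d)
    {r : ℝ} (hr : 0 < r) : IsVariation (ball c r) (fun x => r • φ (r⁻¹ • (x - c))) := by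
  obtain ⟨⟨K, hK⟩, h0⟩ := hφ
  refine ⟨⟨K, LipschitzWith.of_dist_le_mul fun x y => ?_⟩, fun z hz => ?_⟩
  · rw [dist_smul₀, Real.norm_of_nonneg hr.le]
    have := hK.dist_le_mul (r⁻¹ • (x - c)) (r⁻¹ • (y - c))
    rw [dist_smul₀, dist_sub_right, Real.norm_of_nonneg (inv_nonneg.2 hr.le)] at this
    calc r * _ ≤ r * (K * (r⁻¹ * dist x y)) := by gcongr
      _ = K * dist x y := by field_simp
  · beta_reduce
    rw [h0, smul_zero]
    simp only [mem_ball, dist_eq_norm, not_lt, sub_zero, norm_smul, norm_inv,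
      Real.norm_of_nonneg hr.le] at hz ⊢
    rwa [inv_mul_eq_div, le_div_iff₀ hr, one_mul]

/-- Compare x with its radial projection to the sphere, at distance 1 − ‖x‖. For x = 0 any unit
vector serves; nontriviality of the space provides one. -/
theorem norm_le_one_sub_norm [Nontrivial (Vec d)] {K : NNReal} {φ : Vec d → Vec m}
    (hK : LipschitzOnWith K φ (closedBall 0 1)) (h0 : ∀ z ∈ sphere (0 : Vec d) 1, φ z = 0)
    {x : Vec d} (hx : x ∈ closedBall (0 : Vec d) 1) : ‖φ x‖ ≤ K * (1 - ‖x‖) := by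
  obtain ⟨e, he, hd⟩ : ∃ e : Vec d, ‖e‖ = 1 ∧ dist x e = 1 - ‖x‖ := by
    by_cases hx0 : x = 0
    · obtain ⟨e, he⟩ := exists_norm_eq (Vec d) zero_le_one
      exact ⟨e, he, by simp [hx0, he]⟩
    · have hn : ‖x‖ ≠ 0 := by simpa using hx0
      refine ⟨‖x‖⁻¹ • x, by simp [norm_smul, hn], ?_⟩
      rw [dist_eq_norm, show x - ‖x‖⁻¹ • x = (1 - ‖x‖⁻¹) • x by simp [sub_smul], norm_smul]
      have h1 : ‖x‖ ≤ 1 := by simpa using hx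
      have : 1 ≤ ‖x‖⁻¹ := one_le_inv_iff₀.2 ⟨by positivity, h1⟩
      rw [Real.norm_eq_abs, abs_of_nonpos (by linarith)]
      field_simp
      ring
  have := hK.dist_le_mul x hx e (by simp [he])
  rwa [h0 e (by simp [he]), dist_zero_right, hd] at this

/-- Maps of class `W₀^{1,∞}(B)` extend by zero to Lipschitz maps. -/
theorem exists_zero_extension [Nontrivial (Vec d)] {φ : Vec d → Vec m}
    (hφ : φ ∈ lipschitzClass (fun _ : Vec d => (0 : Vec m))) :
    ∃ ψ : Vec d → Vec m, IsVariation (ball 0 1) ψ ∧ EqOn φ ψ (closedBall 0 1) := by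
  obtain ⟨⟨K, hK⟩, h0⟩ := hφ
  refine ⟨(closedBall (0 : Vec d) 1).indicator φ, ⟨⟨K, ?_⟩, ?_⟩, fun x hx => by simp [hx]⟩
  · have key : ∀ x ∈ closedBall (0 : Vec d) 1, ∀ y ∉ closedBall (0 : Vec d) 1,
        ‖φ x‖ ≤ K * dist x y := by
      intro x hx y hy
      refine (norm_le_one_sub_norm hK h0 hx).trans ?_
      gcongr
      have h1 : 1 < ‖y‖ := by simpa using hy
      have := norm_sub_norm_le y x
      rw [dist_comm, dist_eq_norm]
      linarith
    refine LipschitzWith.of_dist_le_mul fun x y => ?_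
    by_cases hx : x ∈ closedBall (0 : Vec d) 1 <;> by_cases hy : y ∈ closedBall (0 : Vec d) 1
    · simpa only [indicator_of_mem hx, indicator_of_mem hy] using hK.dist_le_mul x hx y hy
    · simpa only [indicator_of_mem hx, indicator_of_notMem hy, dist_zero_right] using key x hx y hy
    · simpa only [indicator_of_mem hy, indicator_of_notMem hx, dist_zero_left, dist_comm x y] using
        key y hy x hx
    · simp only [indicator_of_notMem hx, indicator_of_notMem hy, dist_self]
      positivity
  · intro z hz
    by_cases hz' : z ∈ closedBall (0 : Vec d) 1
    · rw [indicator_of_mem hz', h0]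
      simp only [mem_ball, mem_closedBall, mem_sphere, not_lt] at *
      exact le_antisymm hz' hz
    · exact indicator_of_notMem hz' _

theorem IsVariation.mem_lipschitzClass {φ : Vec d → Vec m} (h : IsVariation (ball 0 1) φ) :
    φ ∈ lipschitzClass (fun _ : Vec d => (0 : Vec m)) := by
  obtain ⟨⟨K, hK⟩, h0⟩ := h
  refine ⟨⟨K, hK.lipschitzOnWith⟩, fun z hz => h0 z ?_⟩
  simp only [mem_sphere, mem_ball] at *
  simp [hz]

/-! ### Integrability and scaling of gradient energies. -/

theorem isBoundedOnBounded_of_continuous {W : Mat d m → ℝ} (hW : Continuous W) :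
    IsBoundedOnBounded W := by
  intro R
  obtain ⟨C, hC⟩ := (isCompact_closedBall (0 : Mat d m) R).exists_bound_of_continuousOn
    hW.continuousOn
  exact ⟨C, fun F hF => hC F (by simpa using hF)⟩

theorem integrableOn_of_bound {f : Vec d → ℝ} (hf : Measurable f) {C : ℝ} {D : Set (Vec d)}
    (hC : ∀ x ∈ D, |f x| ≤ C) (hD : volume D ≠ ⊤) (hDm : MeasurableSet D) :
    IntegrableOn f D :=
  ⟨hf.aestronglyMeasurable, HasFiniteIntegral.restrict_of_bounded C hD.lt_top
    ((ae_restrict_iff' hDm).2 (Eventually.of_forall hC))⟩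

theorem measurable_comp_fderiv {g : Mat d m → ℝ} (hg : Measurable g) (u : Vec d → Vec m) :
    Measurable fun x => g (fderiv ℝ u x) :=
  hg.comp (measurable_fderiv ℝ u)

/-- The total function `fderiv` is measurable and bounded by the Lipschitz constant at every point,
so neither continuity of g nor Rademacher's theorem is needed. -/
theorem integrableOn_comp_fderiv {g : Mat d m → ℝ} (hg : Measurable g)
    (hb : IsBoundedOnBounded g) {u : Vec d → Vec m} (hu : ∃ K, LipschitzWith K u)
    {D : Set (Vec d)} (hD : volume D ≠ ⊤) (hDm : MeasurableSet D) :
    IntegrableOn (fun x => g (fderiv ℝ u x)) D := by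
  obtain ⟨K, hK⟩ := hu
  obtain ⟨C, hC⟩ := hb K
  exact integrableOn_of_bound (measurable_comp_fderiv hg u)
    (fun x _ => hC _ (norm_fderiv_le_of_lipschitz ℝ hK)) hD hDm

theorem integrableOn_ball_comp_fderiv {g : Mat d m → ℝ} (hg : Measurable g)
    (hb : IsBoundedOnBounded g) {u : Vec d → Vec m} (hu : ∃ K, LipschitzWith K u)
    (c : Vec d) (r : ℝ) : IntegrableOn (fun x => g (fderiv ℝ u x)) (ball c r) :=
  integrableOn_comp_fderiv hg hb hu measure_ball_lt_top.ne measurableSet_ball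

theorem volume_real_ball (c : Vec d) {r : ℝ} (hr : 0 < r) :
    volume.real (ball c r) = r ^ d * volume.real (ball (0 : Vec d) 1) := by
  have := Measure.addHaar_ball_of_pos (volume : Measure (Vec d)) c hr
  rw [Measure.real, this, ENNReal.toReal_mul, ENNReal.toReal_ofReal (by positivity)]
  simp [Measure.real]

theorem volume_real_ball_pos (c : Vec d) {r : ℝ} (hr : 0 < r) : 0 < volume.real (ball c r) :=
  ENNReal.toReal_pos (measure_ball_pos _ _ hr).ne' measure_ball_lt_top.ne

theorem volume_real_closedBall (c : Vec d) {r : ℝ} (hr : 0 < r) :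
    volume.real (closedBall c r) = volume.real (ball c r) := by
  rw [Measure.real, Measure.real, Measure.addHaar_closedBall _ _ hr.le,
    Measure.addHaar_ball_of_pos _ _ hr]

theorem setIntegral_closedBall (f : Vec d → ℝ) (c : Vec d) {r : ℝ} (hr : 0 < r) :
    ∫ x in closedBall c r, f x = ∫ x in ball c r, f x := by
  refine setIntegral_congr_set (Filter.EventuallyEq.symm ?_)
  refine ae_eq_of_subset_of_measure_ge ball_subset_closedBall ?_
    measurableSet_ball.nullMeasurableSet measure_closedBall_lt_top.ne
  rw [Measure.addHaar_closedBall _ _ hr.le, Measure.addHaar_ball_of_pos _ _ hr]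

/-- No differentiability is required: the affine change of variables preserves it in both
directions, so the default value 0 appears on both sides together. -/
theorem fderiv_rescale (u : Vec d → Vec m) (c : Vec d) {r : ℝ} (hr : 0 < r) (x : Vec d) :
    fderiv ℝ (fun x => r⁻¹ • u (c + r • x)) x = fderiv ℝ u (c + r • x) := by
  have h1 : (fun x => r⁻¹ • u (c + r • x)) = r⁻¹ • (fun x => (fun y => u (c + y)) (r • x)) := rfl
  rw [h1, fderiv_const_smul_field, Pi.smul_apply, fderiv_comp_smul (f := fun y => u (c + y)),
    fderiv_comp_add_left, smul_smul, inv_mul_cancel₀ hr.ne', one_smul]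

theorem setIntegral_ball_rescale (f : Vec d → ℝ) (c : Vec d) {r : ℝ} (hr : 0 < r) :
    ∫ x in ball c r, f x = r ^ d * ∫ x in ball (0 : Vec d) 1, f (c + r • x) := by
  have h1 := Measure.setIntegral_comp_smul_of_pos (volume : Measure (Vec d))
    (fun y => f (c + y)) (ball (0 : Vec d) 1) hr
  have h2 : ∫ x in ball c r, f x = ∫ y in ball (0 : Vec d) r, f (c + y) := by
    have := (measurePreserving_add_left (volume : Measure (Vec d)) c).setIntegral_preimage_emb
      (measurableEmbedding_addLeft c) f (ball c r)
    rw [← this]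
    congr 2
    ext y
    simp
  rw [h2, h1, _root_.smul_ball hr.ne', smul_zero, Real.norm_of_nonneg hr.le, mul_one]
  simp only [finrank_euclideanSpace, Fintype.card_fin, smul_eq_mul]
  rw [mul_inv_cancel_left₀ (by positivity)]

theorem gradEnergy_rescale (g : Mat d m → ℝ) (u : Vec d → Vec m) (c : Vec d) {r : ℝ}
    (hr : 0 < r) :
    ∫ x in ball c r, g (fderiv ℝ u x) =
      r ^ d * ∫ x in ball (0 : Vec d) 1, g (fderiv ℝ (fun x => r⁻¹ • u (c + r • x)) x) := by
  rw [setIntegral_ball_rescale _ c hr]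
  simp only [fderiv_rescale u c hr]

theorem ae_fderiv_clm_add (F : Mat d m) {φ : Vec d → Vec m} (hφ : ∃ K, LipschitzWith K φ) :
    ∀ᵐ x, fderiv ℝ (fun x => F x + φ x) x = F + fderiv ℝ φ x := by
  obtain ⟨K, hK⟩ := hφ
  filter_upwards [hK.ae_differentiableAt (μ := volume)] with x hx
  rw [fderiv_fun_add F.differentiableAt hx, F.fderiv]

theorem setIntegral_fderiv_clm_add (g : Mat d m → ℝ) (F : Mat d m) {φ : Vec d → Vec m}
    (hφ : ∃ K, LipschitzWith K φ) (D : Set (Vec d)) :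
    ∫ x in D, g (fderiv ℝ (fun x => F x + φ x) x) = ∫ x in D, g (F + fderiv ℝ φ x) := by
  refine integral_congr_ae (ae_restrict_of_ae ?_)
  filter_upwards [ae_fderiv_clm_add F hφ] with x hx
  rw [hx]

theorem setAverage_ball_eq (f : Vec d → ℝ) :
    ⨍ z in unitBall d, f z =
      (volume.real (ball (0 : Vec d) 1))⁻¹ * ∫ z in ball (0 : Vec d) 1, f z := by
  rw [setAverage_eq, smul_eq_mul, unitBall]

/-! ### Quasiconvexity at a single matrix. -/

theorem le_setAverage_iff {g : Mat d m → ℝ} {F : Mat d m} {φ : Vec d → Vec m}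
    (hφ : ∃ K, LipschitzWith K φ) :
    g F ≤ ⨍ z in unitBall d, g (F + fderiv ℝ φ z) ↔
      g F * volume.real (ball (0 : Vec d) 1) ≤
        ∫ z in ball (0 : Vec d) 1, g (fderiv ℝ (fun x => F x + φ x) z) := by
  rw [setAverage_ball_eq, setIntegral_fderiv_clm_add g F hφ, inv_mul_eq_div,
    le_div_iff₀ (volume_real_ball_pos _ one_pos)]

theorem IsQuasiconvex.isQuasiconvexAt {g : Mat d m → ℝ} (hg : IsQuasiconvex g) (F : Mat d m) :
    IsQuasiconvexAt g F := fun φ hφ =>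
  (le_setAverage_iff hφ.1).1 (hg.le_average F φ hφ.mem_lipschitzClass)

theorem IsQuasiconvexAt.le_average [Nontrivial (Vec d)] {g : Mat d m → ℝ} {F : Mat d m}
    (hg : IsQuasiconvexAt g F) {φ : Vec d → Vec m}
    (hφ : φ ∈ lipschitzClass (fun _ : Vec d => (0 : Vec m))) :
    g F ≤ ⨍ z in unitBall d, g (F + fderiv ℝ φ z) := by
  obtain ⟨ψ, hψ, he⟩ := exists_zero_extension hφ
  have := (le_setAverage_iff hψ.1).2 (hg ψ hψ)
  rw [setAverage_ball_eq] at this ⊢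
  convert this using 2
  refine setIntegral_congr_fun measurableSet_ball fun x hx => ?_
  have : φ =ᶠ[𝓝 x] ψ := by
    filter_upwards [isOpen_ball.mem_nhds hx] with y hy using he (ball_subset_closedBall hy)
  simp only [this.fderiv_eq]

/-- Quasiconvexity at `F` on an arbitrary ball. -/
theorem IsQuasiconvexAt.le_integral {g : Mat d m → ℝ} {F : Mat d m} (hg : IsQuasiconvexAt g F)
    (c : Vec d) {r : ℝ} (hr : 0 < r) {φ : Vec d → Vec m} (hφ : IsVariation (ball c r) φ) :
    g F * volume.real (ball c r) ≤ ∫ z in ball c r, g (fderiv ℝ (fun x => F x + φ x) z) := by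
  obtain ⟨⟨K, hK⟩, h0⟩ := hφ
  have hψ : IsVariation (ball 0 1) (fun x => r⁻¹ • φ (c + r • x)) := by
    refine ⟨⟨K, LipschitzWith.of_dist_le_mul fun x y => ?_⟩, fun z hz => ?_⟩
    · rw [dist_smul₀, Real.norm_of_nonneg (inv_nonneg.2 hr.le)]
      have := hK.dist_le_mul (c + r • x) (c + r • y)
      rw [dist_add_left, dist_smul₀, Real.norm_of_nonneg hr.le] at this
      calc r⁻¹ * _ ≤ r⁻¹ * (K * (r * dist x y)) := by gcongr
        _ = K * dist x y := by field_simp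
    · beta_reduce
      rw [h0, smul_zero]
      simp only [mem_ball, not_lt, dist_zero_right, dist_self_add_left, norm_smul,
        Real.norm_of_nonneg hr.le] at hz ⊢
      nlinarith
  have h1 := hg _ hψ
  rw [setIntegral_fderiv_clm_add g F ⟨K, hK⟩, setIntegral_ball_rescale _ c hr,
    volume_real_ball c hr]
  rw [setIntegral_fderiv_clm_add g F hψ.1] at h1
  simp only [fderiv_rescale φ c hr] at h1
  calc g F * (r ^ d * volume.real (ball (0 : Vec d) 1))
      = r ^ d * (g F * volume.real (ball (0 : Vec d) 1)) := by ring
    _ ≤ _ := by gcongr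

theorem IsVariation.eventuallyEq_zero {c : Vec d} {r : ℝ} {φ : Vec d → Vec m}
    (hφ : IsVariation (ball c r) φ) {x : Vec d} (hx : x ∉ closedBall c r) :
    φ =ᶠ[𝓝 x] fun _ => 0 := by
  filter_upwards [isClosed_closedBall.isOpen_compl.mem_nhds hx] with y hy
  exact hφ.2 y fun h => hy (ball_subset_closedBall h)

/-! ### Gluing variations on disjoint balls. -/

/-- Energy of a Lipschitz map modified on finitely many disjoint balls. -/
theorem setIntegral_add_sum_variations {ι : Type*} {g : Mat d m → ℝ} (hg : Measurable g)
    (hb : IsBoundedOnBounded g) {u : Vec d → Vec m} (hu : ∃ K, LipschitzWith K u)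
    (s : Finset ι) {c : ι → Vec d} {r : ι → ℝ} (hr : ∀ i ∈ s, 0 < r i)
    {w : ι → Vec d → Vec m} (hw : ∀ i ∈ s, IsVariation (ball (c i) (r i)) (w i))
    (hdisj : (s : Set ι).PairwiseDisjoint fun i => ball (c i) (r i))
    {D : Set (Vec d)} (hD : ∀ i ∈ s, ball (c i) (r i) ⊆ D) (hDm : MeasurableSet D)
    (hDf : volume D ≠ ⊤) :
    ∫ x in D, g (fderiv ℝ (fun x => u x + ∑ i ∈ s, w i x) x) =
      (∫ x in D, g (fderiv ℝ u x)) +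
        ∑ i ∈ s, ((∫ x in ball (c i) (r i), g (fderiv ℝ (fun x => u x + w i x) x)) -
          ∫ x in ball (c i) (r i), g (fderiv ℝ u x)) := by
  classical
  set G : ι → Vec d → ℝ := fun i x => g (fderiv ℝ (fun x => u x + w i x) x) - g (fderiv ℝ u x)
  have hGi : ∀ i ∈ s, IntegrableOn (G i) (ball (c i) (r i)) := fun i hi =>
    (integrableOn_ball_comp_fderiv hg hb ((hw i hi).lipschitz_add hu) _ _).sub
      (integrableOn_ball_comp_fderiv hg hb hu _ _)
  -- The gradients of the `w i` are not controlled on the bounding spheres, but these are null. Off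
  -- them at most one `w i` is nonzero near x, so the gradient is that of u or of a single u + w i.
  have hsph : ∀ᵐ x : Vec d, ∀ i ∈ s, x ∉ sphere (c i) (r i) := by
    refine (Finset.eventually_all s).2 fun i hi => ?_
    exact measure_eq_zero_iff_ae_notMem.1
      (Measure.addHaar_sphere_of_ne_zero volume (c i) (hr i hi).ne')
  have hGs : ∀ i ∈ s, IntegrableOn ((ball (c i) (r i)).indicator (G i)) D := fun i hi =>
    ((integrable_indicator_iff measurableSet_ball).2 (hGi i hi)).integrableOn
  have hpt : ∀ᵐ x : Vec d, g (fderiv ℝ (fun x => u x + ∑ i ∈ s, w i x) x) =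
      g (fderiv ℝ u x) + ∑ i ∈ s, (ball (c i) (r i)).indicator (G i) x := by
    filter_upwards [hsph] with x hx
    by_cases hex : ∃ j ∈ s, x ∈ ball (c j) (r j)
    · obtain ⟨j, hj, hxj⟩ := hex
      have hnot : ∀ y ∈ ball (c j) (r j), ∀ i ∈ s, i ≠ j → y ∉ ball (c i) (r i) :=
        fun y hy i hi hij hyi => (disjoint_left.1 (hdisj hi hj hij)) hyi hy
      rw [Finset.sum_eq_single_of_mem j hj fun i hi hij =>
        indicator_of_notMem (hnot x hxj i hi hij) _, indicator_of_mem hxj]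
      have : (fun x => u x + ∑ i ∈ s, w i x) =ᶠ[𝓝 x] fun x => u x + w j x := by
        filter_upwards [isOpen_ball.mem_nhds hxj] with y hy
        rw [Finset.sum_eq_single_of_mem j hj fun i hi hij => (hw i hi).2 y (hnot y hy i hi hij)]
      simp [G, this.fderiv_eq]
    · push Not at hex
      have hz : ∀ i ∈ s, w i =ᶠ[𝓝 x] fun _ => 0 := fun i hi =>
        (hw i hi).eventuallyEq_zero fun h => by
          have h1 := hex i hi
          have h2 := hx i hi
          simp only [mem_closedBall, mem_ball, mem_sphere] at *
          exact h1 (lt_of_le_of_ne h h2)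
      have : (fun x => u x + ∑ i ∈ s, w i x) =ᶠ[𝓝 x] u := by
        filter_upwards [(Finset.eventually_all s).2 hz] with y hy
        rw [Finset.sum_eq_zero hy, add_zero]
      rw [this.fderiv_eq, Finset.sum_eq_zero fun i hi => indicator_of_notMem (hex i hi) _,
        add_zero]
  have hGe : ∀ i ∈ s, ∫ x in D, (ball (c i) (r i)).indicator (G i) x =
      (∫ x in ball (c i) (r i), g (fderiv ℝ (fun x => u x + w i x) x)) -
          ∫ x in ball (c i) (r i), g (fderiv ℝ u x) := fun i hi => by
    rw [setIntegral_indicator measurableSet_ball, inter_eq_right.2 (hD i hi), integral_sub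
      (integrableOn_ball_comp_fderiv hg hb ((hw i hi).lipschitz_add hu) _ _)
      (integrableOn_ball_comp_fderiv hg hb hu _ _)]
  rw [integral_congr_ae (ae_restrict_of_ae hpt), integral_add
    (integrableOn_comp_fderiv hg hb hu hDf hDm) (integrable_finsetSum s hGs),
    integral_finsetSum s hGs, Finset.sum_congr rfl hGe]

/-- Local improvements of the energy near almost every point can be combined into a single
variation, by a Besicovitch covering argument. -/
theorem exists_variation_of_local {g : Mat d m → ℝ} (hg : Measurable g)
    (hb : IsBoundedOnBounded g) {u : Vec d → Vec m} (hu : ∃ K, LipschitzWith K u)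
    {h : Vec d → ℝ} {B : Set (Vec d)} (hBo : IsOpen B) (hBf : volume B ≠ ⊤)
    (hh : IntegrableOn h B) {ε ε' : ℝ} (hε : 0 ≤ ε) (hε' : 0 < ε')
    (hloc : ∀ᵐ z, z ∈ B → ∀ᶠ r in 𝓝[>] (0 : ℝ), ∃ w : Vec d → Vec m,
      IsVariation (ball z r) w ∧ ∫ x in ball z r, g (fderiv ℝ (fun x => u x + w x) x) ≤
        (∫ x in ball z r, h x) + ε * volume.real (ball z r)) :
    ∃ w : Vec d → Vec m, IsVariation B w ∧ ∫ x in B, g (fderiv ℝ (fun x => u x + w x) x) ≤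
        (∫ x in B, h x) + ε * volume.real B + ε' := by
  classical
  set good : Vec d → ℝ → Prop := fun z r => ∃ w : Vec d → Vec m,
      IsVariation (ball z r) w ∧ ∫ x in ball z r, g (fderiv ℝ (fun x => u x + w x) x) ≤
        (∫ x in ball z r, h x) + ε * volume.real (ball z r) with hgood
  set A : Set (Vec d) := {z ∈ B | ∀ᶠ r in 𝓝[>] (0 : ℝ), good z r} with hA
  have hAB : volume (B \ A) = 0 := by
    rw [measure_eq_zero_iff_ae_notMem]
    filter_upwards [hloc] with z hz hzA
    exact hzA.2 ⟨hzA.1, hz hzA.1⟩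
  obtain ⟨t, r, htc, htA, hr, hcov, hdisj⟩ :=
    Besicovitch.exists_disjoint_closedBall_covering_ae (volume : Measure (Vec d))
      (fun z => {r | closedBall z r ⊆ B ∧ good z r}) A (by
        intro z hz δ hδ
        have h1 : ∀ᶠ r in 𝓝[>] (0 : ℝ), closedBall z r ⊆ B :=
          (eventually_closedBall_subset (hBo.mem_nhds hz.1)).filter_mono nhdsWithin_le_nhds
        have h2 : ∀ᶠ r in 𝓝[>] (0 : ℝ), r ∈ Ioo 0 δ := Ioo_mem_nhdsGT hδ
        obtain ⟨r, h1, h2, h3⟩ := (h1.and (h2.and hz.2)).exists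
        exact ⟨r, ⟨h1, h3⟩, h2⟩) (fun _ => 1) (fun _ _ => one_pos)
  have : Countable t := htc.to_subtype
  have hpos : ∀ i : t, 0 < r i := fun i => (hr i i.2).2.1
  have hsub : ∀ i : t, closedBall (i : Vec d) (r i) ⊆ B := fun i => (hr i i.2).1.1
  choose w hw hwle using fun i : t => (hr i i.2).1.2
  -- q is the density of the gain: up to ε per unit volume, a replacement on a ball lowers the
  -- energy by at least the integral of q there.
  set q : Vec d → ℝ := fun x => g (fderiv ℝ u x) - h x
  have hgu : IntegrableOn (fun x => g (fderiv ℝ u x)) B :=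
    integrableOn_comp_fderiv hg hb hu hBf hBo.measurableSet
  have hq : IntegrableOn q B := hgu.sub hh
  have hUB : (⋃ i : t, closedBall (i : Vec d) (r i)) ⊆ B := iUnion_subset hsub
  have hsum := hasSum_integral_iUnion (f := q) (μ := volume)
    (s := fun i : t => closedBall (i : Vec d) (r i))
    (fun i => measurableSet_closedBall)
    (fun i j hij => hdisj i.2 j.2 fun h => hij (Subtype.ext h)) (hq.mono_set hUB)
  have hU : ∫ x in ⋃ i : t, closedBall (i : Vec d) (r i), q x = ∫ x in B, q x := by
    refine setIntegral_congr_set (Filter.EventuallyEq.symm ?_)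
    refine (ae_le_set.2 ?_).antisymm (ae_le_set.2 (by rw [sdiff_eq_empty.2 hUB, measure_empty]))
    refine measure_mono_null ?_ (measure_union_null hAB hcov)
    intro x hx
    by_cases hxA : x ∈ A
    · exact Or.inr ⟨hxA, by simpa using hx.2⟩
    · exact Or.inl ⟨hx.1, hxA⟩
  rw [hU] at hsum
  -- Finitely many balls already collect the gain up to ε'. Stopping there keeps the sum Lipschitz,
  -- although the constants of the `w i` need not be uniformly bounded.
  obtain ⟨s, hs⟩ := (hsum.eventually (lt_mem_nhds (sub_lt_self _ hε'))).exists
  have hd : (s : Set t).PairwiseDisjoint fun i => ball (i : Vec d) (r i) :=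
    fun i _ j _ hij => (hdisj i.2 j.2 fun h => hij (Subtype.ext h)).mono ball_subset_closedBall
      ball_subset_closedBall
  have hsub' : ∀ i ∈ s, ball (i : Vec d) (r i) ⊆ B := fun i _ =>
    ball_subset_closedBall.trans (hsub i)
  refine ⟨fun x => ∑ i ∈ s, w i x, IsVariation.sum s fun i hi => (hw i).mono (hsub' i hi), ?_⟩
  rw [setIntegral_add_sum_variations hg hb hu s (fun i _ => hpos i) (fun i _ => hw i) hd hsub'
    hBo.measurableSet hBf]
  have hvol : ∑ i ∈ s, volume.real (ball (i : Vec d) (r i)) ≤ volume.real B := by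
    rw [← measureReal_biUnion_finset hd (fun _ _ => measurableSet_ball)
      (fun _ _ => measure_ball_lt_top.ne)]
    exact measureReal_mono (iUnion₂_subset hsub') hBf
  have hqi : ∀ i : t, ∫ x in closedBall (i : Vec d) (r i), q x =
      (∫ x in ball (i : Vec d) (r i), g (fderiv ℝ u x)) - ∫ x in ball (i : Vec d) (r i), h x := by
    intro i
    have hs' := ball_subset_closedBall.trans (hsub i)
    rw [setIntegral_closedBall _ _ (hpos i), integral_sub (hgu.mono_set hs') (hh.mono_set hs')]
  have hle : ∑ i ∈ s, ((∫ x in ball (i : Vec d) (r i), g (fderiv ℝ (fun x => u x + w i x) x)) -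
      ∫ x in ball (i : Vec d) (r i), g (fderiv ℝ u x)) ≤
      ∑ i ∈ s, (ε * volume.real (ball (i : Vec d) (r i)) -
        ∫ x in closedBall (i : Vec d) (r i), q x) := by
    refine Finset.sum_le_sum fun i _ => ?_
    rw [hqi i]
    linarith [hwle i]
  have hsplit : ∑ i ∈ s, (ε * volume.real (ball (i : Vec d) (r i)) -
      ∫ x in closedBall (i : Vec d) (r i), q x) = ε * ∑ i ∈ s, volume.real (ball (i : Vec d) (r i)) -
        ∑ i ∈ s, ∫ x in closedBall (i : Vec d) (r i), q x := by
    rw [Finset.sum_sub_distrib, Finset.mul_sum]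
  have hqB : ∫ x in B, q x = (∫ x in B, g (fderiv ℝ u x)) - ∫ x in B, h x := integral_sub hgu hh
  have := mul_le_mul_of_nonneg_left hvol hε
  linarith

/-! ### Dacorogna's relaxation and the quasiconvex envelope. -/

/-- The relaxed energy density given by Dacorogna's formula. -/
def relaxation (W : Mat d m → ℝ) (F : Mat d m) : ℝ :=
  ⨅ φ : {φ : Vec d → Vec m // IsVariation (ball 0 1) φ},
    (volume.real (ball (0 : Vec d) 1))⁻¹ * ∫ z in ball (0 : Vec d) 1, W (F + fderiv ℝ φ.1 z)

section relaxation

variable {W : Mat d m → ℝ}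

theorem le_inv_mul_integral (hW : Continuous W) {b : ℝ} (hb : ∀ F, b ≤ W F) (F : Mat d m)
    {φ : Vec d → Vec m} (hφ : IsVariation (ball 0 1) φ) :
    b ≤ (volume.real (ball (0 : Vec d) 1))⁻¹ *
      ∫ z in ball (0 : Vec d) 1, W (F + fderiv ℝ φ z) := by
  have hV := volume_real_ball_pos (0 : Vec d) one_pos
  rw [inv_mul_eq_div, le_div_iff₀ hV, ← setIntegral_fderiv_clm_add W F hφ.1]
  calc b * volume.real (ball (0 : Vec d) 1) = ∫ z in ball (0 : Vec d) 1, b := by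
        rw [setIntegral_const, smul_eq_mul, mul_comm]
    _ ≤ _ := setIntegral_mono (integrableOn_const measure_ball_lt_top.ne)
        (integrableOn_ball_comp_fderiv hW.measurable (isBoundedOnBounded_of_continuous hW)
          (hφ.lipschitz_add (lipschitz_clm F)) _ _) fun z => hb _

theorem bddBelow_relaxation (hW : Continuous W) (hbd : BddBelow (range W)) (F : Mat d m) :
    BddBelow (range fun φ : {φ : Vec d → Vec m // IsVariation (ball 0 1) φ} =>
      (volume.real (ball (0 : Vec d) 1))⁻¹ *
        ∫ z in ball (0 : Vec d) 1, W (F + fderiv ℝ φ.1 z)) := by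
  obtain ⟨b, hb⟩ := hbd
  refine ⟨b, ?_⟩
  rintro _ ⟨φ, rfl⟩
  exact le_inv_mul_integral hW (fun F => hb ⟨F, rfl⟩) F φ.2

instance : Nonempty {φ : Vec d → Vec m // IsVariation (ball 0 1) φ} :=
  ⟨⟨_, IsVariation.zero _⟩⟩

theorem relaxation_mul_le (hW : Continuous W) (hbd : BddBelow (range W)) (F : Mat d m)
    {φ : Vec d → Vec m} (hφ : IsVariation (ball 0 1) φ) :
    relaxation W F * volume.real (ball (0 : Vec d) 1) ≤
      ∫ z in ball (0 : Vec d) 1, W (fderiv ℝ (fun x => F x + φ x) z) := by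
  have := ciInf_le (bddBelow_relaxation hW hbd F) ⟨φ, hφ⟩
  rwa [inv_mul_eq_div, le_div_iff₀ (volume_real_ball_pos _ one_pos),
    ← setIntegral_fderiv_clm_add W F hφ.1] at this

theorem relaxation_le (hW : Continuous W) (hbd : BddBelow (range W)) (F : Mat d m) :
    relaxation W F ≤ W F := by
  have := relaxation_mul_le hW hbd F (IsVariation.zero _)
  simp only [add_zero] at this
  have h1 : ∀ z, fderiv ℝ (fun x => F x) z = F := fun z => F.fderiv
  simp only [h1, setIntegral_const, smul_eq_mul] at this
  have hV := volume_real_ball_pos (0 : Vec d) one_pos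
  rw [mul_comm] at this
  exact le_of_mul_le_mul_left this hV

theorem le_relaxation (hW : Continuous W) {b : ℝ} (hb : ∀ F, b ≤ W F) (F : Mat d m) :
    b ≤ relaxation W F :=
  le_ciInf fun φ => le_inv_mul_integral hW hb F φ.2

theorem exists_lt_relaxation_add (W : Mat d m → ℝ) (F : Mat d m) {ε : ℝ} (hε : 0 < ε) :
    ∃ φ : Vec d → Vec m, IsVariation (ball 0 1) φ ∧
      ∫ z in ball (0 : Vec d) 1, W (fderiv ℝ (fun x => F x + φ x) z) ≤
        (relaxation W F + ε) * volume.real (ball (0 : Vec d) 1) := by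
  obtain ⟨φ, hφ⟩ := exists_lt_of_ciInf_lt (lt_add_of_pos_right (relaxation W F) hε)
  refine ⟨φ.1, φ.2, ?_⟩
  rw [inv_mul_eq_div, div_lt_iff₀ (volume_real_ball_pos _ one_pos)] at hφ
  rw [setIntegral_fderiv_clm_add W F φ.2.1]
  exact hφ.le

theorem IsQuasiconvexAt.le_relaxation {F : Mat d m} (h : IsQuasiconvexAt W F) :
    W F ≤ relaxation W F :=
  le_ciInf fun φ => by
    rw [inv_mul_eq_div, le_div_iff₀ (volume_real_ball_pos _ one_pos),
      ← setIntegral_fderiv_clm_add W F φ.2.1]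
    exact h φ.1 φ.2

theorem continuous_setIntegral_add_fderiv (hW : Continuous W) {φ : Vec d → Vec m}
    (hφ : ∃ K, LipschitzWith K φ) :
    Continuous fun F : Mat d m => ∫ z in ball (0 : Vec d) 1, W (F + fderiv ℝ φ z) := by
  obtain ⟨K, hK⟩ := hφ
  refine continuous_iff_continuousAt.2 fun F₀ => ?_
  obtain ⟨C, hC⟩ := isBoundedOnBounded_of_continuous hW (‖F₀‖ + 1 + K)
  refine continuousAt_of_dominated (bound := fun _ => C) ?_ ?_ ?_ ?_
  · exact Eventually.of_forall fun F =>
      (hW.measurable.comp ((measurable_fderiv ℝ φ).const_add F)).aestronglyMeasurable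
  · filter_upwards [ball_mem_nhds F₀ one_pos] with F hF
    refine Eventually.of_forall fun z => hC _ ?_
    have h1 := norm_fderiv_le_of_lipschitz ℝ hK (x₀ := z)
    have h2 : ‖F - F₀‖ < 1 := by simpa [dist_eq_norm] using hF
    calc ‖F + fderiv ℝ φ z‖ = ‖F₀ + (F - F₀) + fderiv ℝ φ z‖ := by simp
      _ ≤ ‖F₀‖ + ‖F - F₀‖ + ‖fderiv ℝ φ z‖ := norm_add₃_le
      _ ≤ _ := by gcongr
  · exact integrableOn_const measure_ball_lt_top.ne
  · exact Eventually.of_forall fun z =>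
      (hW.comp (continuous_id.add continuous_const)).continuousAt

/-- Each competitor contributes a continuous function of F. An infimum of such functions, even over
an uncountable family, is upper semicontinuous and therefore Borel. -/
theorem measurable_relaxation (hW : Continuous W) (hbd : BddBelow (range W)) :
    Measurable (relaxation W) :=
  (upperSemicontinuous_ciInf (bddBelow_relaxation hW hbd) fun φ =>
    (continuous_const.mul (continuous_setIntegral_add_fderiv hW φ.2.1)).upperSemicontinuous
    ).measurable

theorem isBoundedOnBounded_relaxation (hW : Continuous W) (hbd : BddBelow (range W)) :
    IsBoundedOnBounded (relaxation W) := by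
  intro R
  obtain ⟨C, hC⟩ := isBoundedOnBounded_of_continuous hW R
  obtain ⟨b, hb⟩ := id hbd
  refine ⟨max C (-b), fun F hF => abs_le'.2 ⟨?_, ?_⟩⟩
  · exact ((relaxation_le hW hbd F).trans ((le_abs_self _).trans (hC F hF))).trans (le_max_left _ _)
  · exact (neg_le_neg (le_relaxation hW (fun F => hb ⟨F, rfl⟩) F)).trans (le_max_right _ _)

/-- Cut-off function equal to `1` on `ball z ((1 - δ) r)` and vanishing off `ball z r`. -/
def radialCutoff (z : Vec d) (δ r : ℝ) (x : Vec d) : ℝ :=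
  max 0 (min 1 ((r - dist x z) / (δ * r)))

theorem radialCutoff_nonneg (z : Vec d) (δ r : ℝ) (x : Vec d) : 0 ≤ radialCutoff z δ r x :=
  le_max_left _ _

theorem radialCutoff_le_one (z : Vec d) (δ r : ℝ) (x : Vec d) : radialCutoff z δ r x ≤ 1 :=
  max_le zero_le_one (min_le_left _ _)

theorem radialCutoff_eq_one {z : Vec d} {δ r : ℝ} (hδ : 0 < δ) (hr : 0 < r) {x : Vec d}
    (hx : dist x z ≤ (1 - δ) * r) : radialCutoff z δ r x = 1 := by
  have : 1 ≤ (r - dist x z) / (δ * r) := by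
    rw [le_div_iff₀ (by positivity)]
    linarith
  rw [radialCutoff, min_eq_left this, max_eq_right zero_le_one]

theorem radialCutoff_eq_zero {z : Vec d} {δ r : ℝ} (hδ : 0 < δ) (hr : 0 < r) {x : Vec d}
    (hx : x ∉ ball z r) : radialCutoff z δ r x = 0 := by
  have h1 : r ≤ dist x z := by simpa using hx
  have : (r - dist x z) / (δ * r) ≤ 0 :=
    div_nonpos_of_nonpos_of_nonneg (by linarith) (by positivity)
  rw [radialCutoff, max_eq_left ((min_le_right _ _).trans this)]

theorem abs_radialCutoff_sub_le (z : Vec d) {δ r : ℝ} (hδ : 0 < δ) (hr : 0 < r) (x y : Vec d) :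
    |radialCutoff z δ r x - radialCutoff z δ r y| ≤ dist x y / (δ * r) := by
  have h1 : |radialCutoff z δ r x - radialCutoff z δ r y| ≤
      |(r - dist x z) / (δ * r) - (r - dist y z) / (δ * r)| := by
    refine (abs_max_sub_max_le_max _ _ _ _).trans (max_le (by simp) ?_)
    exact (abs_min_sub_min_le_max _ _ _ _).trans (max_le (by simp) le_rfl)
  refine h1.trans ?_
  rw [← sub_div, abs_div, abs_of_pos (mul_pos hδ hr)]
  gcongr
  have := abs_dist_sub_le x y z
  rw [show r - dist x z - (r - dist y z) = -(dist x z - dist y z) by ring, abs_neg]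
  exact this

/-- A Lipschitz map multiplied by a cut-off function at whose scale it is small. -/
theorem lipschitzWith_radialCutoff_smul {z : Vec d} {δ r M : ℝ} (hδ : 0 < δ) (hr : 0 < r)
    {L : NNReal} {D : Vec d → Vec m} (hD : LipschitzWith L D)
    (hM : ∀ x ∈ ball z r, ‖D x‖ ≤ M) :
    LipschitzWith (L + (M / (δ * r)).toNNReal) fun x => radialCutoff z δ r x • D x := by
  have key : ∀ x ∈ ball z r, ∀ y, dist (radialCutoff z δ r x • D x) (radialCutoff z δ r y • D y) ≤
      (L + (M / (δ * r)).toNNReal : NNReal) * dist x y := by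
    intro x hx y
    have hM0 : 0 ≤ M := (norm_nonneg _).trans (hM x hx)
    rw [NNReal.coe_add, Real.coe_toNNReal _ (by positivity), dist_eq_norm,
      show radialCutoff z δ r x • D x - radialCutoff z δ r y • D y =
        radialCutoff z δ r y • (D x - D y) +
          (radialCutoff z δ r x - radialCutoff z δ r y) • D x by
        rw [smul_sub, sub_smul]; abel]
    refine (norm_add_le _ _).trans ?_
    rw [norm_smul, norm_smul, Real.norm_of_nonneg (radialCutoff_nonneg _ _ _ _),
      Real.norm_eq_abs, add_mul]
    have h1 : ‖D x - D y‖ ≤ L * dist x y := by simpa [dist_eq_norm] using hD.dist_le_mul x y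
    have h2 : radialCutoff z δ r y * ‖D x - D y‖ ≤ 1 * (L * dist x y) :=
      mul_le_mul (radialCutoff_le_one _ _ _ _) h1 (norm_nonneg _) zero_le_one
    have h3 : |radialCutoff z δ r x - radialCutoff z δ r y| * ‖D x‖ ≤ dist x y / (δ * r) * M :=
      mul_le_mul (abs_radialCutoff_sub_le z hδ hr x y) (hM x hx) (norm_nonneg _) (by positivity)
    calc _ ≤ 1 * (L * dist x y) + dist x y / (δ * r) * M := add_le_add h2 h3
      _ = _ := by ring
  refine LipschitzWith.of_dist_le_mul fun x y => ?_
  by_cases hx : x ∈ ball z r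
  · exact key x hx y
  · by_cases hy : y ∈ ball z r
    · rw [dist_comm, dist_comm x y]
      exact key y hy x
    · simp only [radialCutoff_eq_zero hδ hr hx, radialCutoff_eq_zero hδ hr hy, zero_smul, dist_self]
      positivity

/-- Integral over a ball of a function that is bounded on an outer shell. -/
theorem setIntegral_ball_le_of_shell {f : Vec d → ℝ} {z : Vec d} {s r C : ℝ} (hs : 0 < s)
    (hsr : s ≤ r) (hf : IntegrableOn f (ball z r))
    (hC : ∀ x ∈ ball z r \ closedBall z s, f x ≤ C) :
    ∫ x in ball z r, f x ≤
      (∫ x in ball z s, f x) + C * (volume.real (ball z r) - volume.real (ball z s)) := by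
  rcases hsr.eq_or_lt with rfl | hlt
  · simp
  have hsub : closedBall z s ⊆ ball z r := closedBall_subset_ball hlt
  have h1 := integral_inter_add_sdiff (μ := volume) measurableSet_closedBall hf (t := closedBall z s)
  rw [inter_eq_right.2 hsub, setIntegral_closedBall _ _ hs] at h1
  have h2 : volume.real (ball z r \ closedBall z s) =
      volume.real (ball z r) - volume.real (ball z s) := by
    rw [measureReal_sdiff hsub measurableSet_closedBall,
      volume_real_closedBall z hs]
  have h3 : ∫ x in ball z r \ closedBall z s, f x ≤
      ∫ x in ball z r \ closedBall z s, C :=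
    setIntegral_mono_on (hf.mono_set sdiff_subset)
      (integrableOn_const ((measure_mono sdiff_subset).trans_lt measure_ball_lt_top).ne)
      (measurableSet_ball.diff measurableSet_closedBall) hC
  rw [setIntegral_const, h2, smul_eq_mul, mul_comm] at h3
  linarith

/-- Blow-up at a point of differentiability: a thin shell interpolates between u and its tangent
map, and a rescaled, nearly optimal competitor for `relaxation W` at ∇u(z) is placed in the inner
ball. The shell costs little because its relative volume is small and the gradients in it are
bounded independently of r and δ. -/
theorem exists_local_replacement (hW : Continuous W) {K : NNReal}
    {u : Vec d → Vec m} (hu : LipschitzWith K u) {z : Vec d} (hz : DifferentiableAt ℝ u z)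
    {ε : ℝ} (hε : 0 < ε) :
    ∀ᶠ r in 𝓝[>] (0 : ℝ), ∃ w : Vec d → Vec m, IsVariation (ball z r) w ∧
      ∫ x in ball z r, W (fderiv ℝ (fun x => u x + w x) x) ≤
        (relaxation W (fderiv ℝ u z) + ε) * volume.real (ball z r) := by
  set A := fderiv ℝ u z with hA
  have hAK : ‖A‖ ≤ K := norm_fderiv_le_of_lipschitz ℝ hu
  obtain ⟨ψ, hψ, hψle⟩ := exists_lt_relaxation_add W A (half_pos hε)
  -- Gradient bound in the shell: K from u, 2K from the correction D, and 1 from the cut-off, whose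
  -- slope 1/(δr) multiplies ‖D‖ ≤ δr.
  obtain ⟨C, hC⟩ := isBoundedOnBounded_of_continuous hW (3 * K + 1)
  set Z := relaxation W A
  -- The shell has relative volume 1 − (1 − δ)^d. This δ makes its excess cost over the level Z +
  -- ε/2 less than ε/2 per unit volume.
  obtain ⟨δ, hδ0, hδ1, hδ⟩ : ∃ δ : ℝ, 0 < δ ∧ δ < 1 ∧
      (1 - (1 - δ) ^ d) * (C - Z - ε / 2) < ε / 2 := by
    have hc : Continuous fun δ : ℝ => (1 - (1 - δ) ^ d) * (C - Z - ε / 2) := by fun_prop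
    have h1 : ∀ᶠ δ in 𝓝[>] (0 : ℝ), (1 - (1 - δ) ^ d) * (C - Z - ε / 2) < ε / 2 := by
      refine (hc.tendsto 0).eventually_lt_const (by simpa using half_pos hε) |>.filter_mono
        nhdsWithin_le_nhds
    obtain ⟨δ, h1, h2⟩ := (h1.and (Ioo_mem_nhdsGT (zero_lt_one' ℝ))).exists
    exact ⟨δ, h2.1, h2.2, h1⟩
  set D : Vec d → Vec m := fun x => u z + A (x - z) - u x with hD
  have hDL : LipschitzWith (2 * K) D := by
    refine LipschitzWith.of_dist_le_mul fun x y => ?_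
    rw [dist_eq_norm, show D x - D y = A (x - y) - (u x - u y) by
      simp only [hD, map_sub]; abel]
    have h1 : ‖A (x - y)‖ ≤ K * dist x y := by
      rw [dist_eq_norm]
      exact (A.le_opNorm _).trans (by gcongr)
    have h2 : ‖u x - u y‖ ≤ K * dist x y := by simpa [dist_eq_norm] using hu.dist_le_mul x y
    refine (norm_sub_le _ _).trans ?_
    push_cast
    linarith
  have hsmall : ∀ᶠ x in 𝓝 z, ‖D x‖ ≤ δ * ‖x - z‖ := by
    have := hz.hasFDerivAt.isLittleO.bound hδ0
    filter_upwards [this] with x hx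
    have hneg : -D x = u x - u z - A (x - z) := by simp only [hD]; abel
    rw [← norm_neg, hneg]
    exact hx
  obtain ⟨ρ, hρ, hρD⟩ := Metric.eventually_nhds_iff.1 hsmall
  filter_upwards [Ioo_mem_nhdsGT hρ] with r hr
  obtain ⟨hr0, hrρ⟩ := hr
  set s := (1 - δ) * r with hs
  have hs0 : 0 < s := mul_pos (by linarith) hr0
  have hsr : s ≤ r := by nlinarith
  set η := radialCutoff z δ r
  have hDM : ∀ x ∈ ball z r, ‖D x‖ ≤ δ * r := by
    intro x hx
    have hx' : dist x z < r := hx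
    refine (hρD (hx'.trans hrρ)).trans ?_
    rw [dist_eq_norm] at hx'
    gcongr
  have hηD := lipschitzWith_radialCutoff_smul hδ0 hr0 hDL hDM
  rw [div_self (by positivity), Real.toNNReal_one] at hηD
  have hvη : IsVariation (ball z r) fun x => η x • D x :=
    ⟨⟨_, hηD⟩, fun x hx => by simp [η, radialCutoff_eq_zero hδ0 hr0 hx]⟩
  have hvψ := hψ.rescale z hs0
  have hw := hvη.add (hvψ.mono (ball_subset_ball hsr))
  refine ⟨_, hw, ?_⟩
  refine (setIntegral_ball_le_of_shell hs0 hsr (C := C) (integrableOn_ball_comp_fderiv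
    hW.measurable (isBoundedOnBounded_of_continuous hW) (hw.lipschitz_add ⟨K, hu⟩) _ _) ?_).trans ?_
  · intro x hx
    have h1 : (fun x => u x + (η x • D x + s • ψ (s⁻¹ • (x - z)))) =ᶠ[𝓝 x]
        fun x => u x + η x • D x := by
      filter_upwards [hvψ.eventuallyEq_zero hx.2] with y hy
      rw [hy, add_zero]
    rw [h1.fderiv_eq]
    refine (le_abs_self _).trans (hC _ ?_)
    refine (norm_fderiv_le_of_lipschitz ℝ (hu.add hηD)).trans ?_
    push_cast
    linarith
  · have h1 : ∫ x in ball z s, W (fderiv ℝ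
        (fun x => u x + (η x • D x + s • ψ (s⁻¹ • (x - z)))) x) =
        s ^ d * ∫ x in ball (0 : Vec d) 1, W (fderiv ℝ (fun x => A x + ψ x) x) := by
      rw [gradEnergy_rescale W _ z hs0]
      congr 1
      refine setIntegral_congr_fun measurableSet_ball fun x hx => ?_
      have h2 : (fun x => s⁻¹ • (u (z + s • x) + (η (z + s • x) • D (z + s • x) +
          s • ψ (s⁻¹ • ((z + s • x) - z))))) =ᶠ[𝓝 x] fun x => s⁻¹ • u z + (A x + ψ x) := by
        filter_upwards [isOpen_ball.mem_nhds hx] with y hy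
        have hη : η (z + s • y) = 1 := by
          refine radialCutoff_eq_one hδ0 hr0 ?_
          have : ‖y‖ < 1 := by simpa using hy
          rw [dist_self_add_left, norm_smul, Real.norm_of_nonneg hs0.le]
          nlinarith
        rw [hη, one_smul]
        simp only [hD, add_sub_cancel_left, map_smul, smul_add, smul_sub, smul_smul,
          inv_mul_cancel₀ hs0.ne', one_smul]
        abel
      simp only [h2.fderiv_eq, fderiv_const_add]
    rw [h1, volume_real_ball z hr0, volume_real_ball z hs0]
    have h2 := mul_le_mul_of_nonneg_left hψle (pow_nonneg hs0.le d)
    set V := volume.real (ball (0 : Vec d) 1)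
    have hV : 0 < V := volume_real_ball_pos _ one_pos
    have h3 : s ^ d = (1 - δ) ^ d * r ^ d := by rw [hs, mul_pow]
    have h4 : (1 - (1 - δ) ^ d) * (C - Z - ε / 2) * (r ^ d * V) ≤ ε / 2 * (r ^ d * V) :=
      mul_le_mul_of_nonneg_right hδ.le (by positivity)
    rw [h3] at h2 ⊢
    linarith

/-- Given φ, a further variation w brings the W-energy of F + φ + w to within ε of the relaxed
energy of F + φ: replace locally at frozen gradients, use Lebesgue differentiation to compare frozen
and actual values, and glue. Since φ + w is itself a competitor in the formula for `relaxation W F`,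
the inequality follows. -/
theorem isQuasiconvexAt_relaxation (hW : Continuous W) (hbd : BddBelow (range W))
    (F : Mat d m) : IsQuasiconvexAt (relaxation W) F := by
  intro φ hφ
  set u : Vec d → Vec m := fun x => F x + φ x with hu
  have huL : ∃ K, LipschitzWith K u := hφ.lipschitz_add (lipschitz_clm F)
  set h : Vec d → ℝ := fun x => relaxation W (fderiv ℝ u x) with hh
  have hm := measurable_relaxation hW hbd
  have hbb := isBoundedOnBounded_relaxation hW hbd
  have hWb := isBoundedOnBounded_of_continuous hW
  have hloc : LocallyIntegrable h volume := fun x =>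
    ⟨ball x 1, ball_mem_nhds _ one_pos, integrableOn_ball_comp_fderiv hm hbb huL x 1⟩
  refine le_of_forall_pos_le_add fun ε hε => ?_
  set V := volume.real (ball (0 : Vec d) 1) with hV
  have hV0 : 0 < V := volume_real_ball_pos _ one_pos
  -- κ is split equally between the replacement and the Lebesgue-point error. Together they cost κV
  -- = ε/2; the other ε/2 pays for the finite truncation of the covering.
  set κ := ε / (2 * V) with hκ
  have hκ0 : 0 < κ := by positivity
  obtain ⟨w, hw, hwle⟩ := exists_variation_of_local hW.measurable hWb huL isOpen_ball
    measure_ball_lt_top.ne (integrableOn_ball_comp_fderiv hm hbb huL 0 1) hκ0.le (half_pos hε) (by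
      obtain ⟨K, hK⟩ := huL
      filter_upwards [(Besicovitch.vitaliFamily (volume : Measure (Vec d))).ae_tendsto_average hloc,
        hK.ae_differentiableAt (μ := volume)] with z hz hdz _
      have h1 := exists_local_replacement hW hK hdz (half_pos hκ0)
      have h2 := (hz.comp (Besicovitch.tendsto_filterAt volume z)).eventually
        (lt_mem_nhds (sub_lt_self _ (half_pos hκ0)))
      filter_upwards [h1, h2, self_mem_nhdsWithin] with r ⟨w, hw, hwle⟩ h2 hr
      refine ⟨w, hw, hwle.trans ?_⟩
      have hr0 : 0 < r := hr
      simp only [Function.comp, setAverage_eq, smul_eq_mul] at h2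
      rw [setIntegral_closedBall _ _ hr0, volume_real_closedBall _ hr0, inv_mul_eq_div,
        lt_div_iff₀ (volume_real_ball_pos _ hr0)] at h2
      simp only [hh] at h2 ⊢
      linarith)
  have h1 := relaxation_mul_le hW hbd F (hφ.add hw)
  have h2 : (fun x => F x + (φ x + w x)) = fun x => u x + w x := by
    ext1 x; simp [hu, add_assoc]
  rw [h2] at h1
  refine h1.trans (hwle.trans ?_)
  have : κ * V = ε / 2 := by rw [hκ]; field_simp
  rw [this]
  simp only [hh]
  linarith

theorem isQuasiconvex_relaxation [Nontrivial (Vec d)] (hW : Continuous W)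
    (hbd : BddBelow (range W)) : IsQuasiconvex (relaxation W) :=
  ⟨measurable_relaxation hW hbd, isBoundedOnBounded_relaxation hW hbd,
    fun F _ hφ => (isQuasiconvexAt_relaxation hW hbd F).le_average hφ⟩

/-- The quasiconvex envelope touches `W` exactly where `W` is quasiconvex. -/
theorem quasiconvexEnvelope_eq_iff [Nontrivial (Vec d)] (hW : Continuous W)
    (hbd : BddBelow (range W)) (F : Mat d m) :
    quasiconvexEnvelope W F = W F ↔ IsQuasiconvexAt W F := by
  have hq := isQuasiconvex_relaxation hW hbd
  have hbdd : BddAbove {r : ℝ | ∃ g : Mat d m → ℝ, IsQuasiconvex g ∧ (∀ G, g G ≤ W G) ∧ g F = r} :=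
    ⟨W F, by rintro _ ⟨g, -, hg, rfl⟩; exact hg F⟩
  -- The relaxation is itself admissible in the supremum, which makes the supremum meaningful and
  -- bounds it from below.
  have hmem : relaxation W F ∈
      {r : ℝ | ∃ g : Mat d m → ℝ, IsQuasiconvex g ∧ (∀ G, g G ≤ W G) ∧ g F = r} :=
    ⟨_, hq, relaxation_le hW hbd, rfl⟩
  constructor
  · intro h φ hφ
    refine le_of_forall_pos_le_add fun ε hε => ?_
    have hV : 0 < volume.real (ball (0 : Vec d) 1) := volume_real_ball_pos _ one_pos
    obtain ⟨_, ⟨g, hg, hgW, rfl⟩, hlt⟩ := exists_lt_of_lt_csSup ⟨_, hmem⟩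
      (show W F - ε / volume.real (ball (0 : Vec d) 1) < quasiconvexEnvelope W F by
        rw [h]; exact sub_lt_self _ (by positivity))
    have h1 := hg.isQuasiconvexAt F φ hφ
    have hL := hφ.lipschitz_add (lipschitz_clm F)
    have h2 : ∫ z in ball (0 : Vec d) 1, g (fderiv ℝ (fun x => F x + φ x) z) ≤
        ∫ z in ball (0 : Vec d) 1, W (fderiv ℝ (fun x => F x + φ x) z) :=
      setIntegral_mono (integrableOn_ball_comp_fderiv hg.measurable hg.locallyBounded hL _ _)
        (integrableOn_ball_comp_fderiv hW.measurable (isBoundedOnBounded_of_continuous hW) hL _ _)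
        fun z => hgW _
    have h3 := mul_le_mul_of_nonneg_right hlt.le hV.le
    rw [sub_mul, div_mul_cancel₀ _ hV.ne'] at h3
    linarith
  · intro h
    refine le_antisymm (csSup_le ⟨_, hmem⟩ ?_) (h.le_relaxation.trans (le_csSup hbdd hmem))
    rintro _ ⟨g, -, hg, rfl⟩
    exact hg F

end relaxation

/-! ### Sawtooth laminates. -/

theorem tensor_apply (a : Vec m) (n x : Vec d) : tensor a n x = inner ℝ x n • a := by
  rw [tensor, InnerProductSpace.rankOne_apply, real_inner_comm]

theorem abs_inner_le_norm_of_unit {n : Vec d} (hn : ‖n‖ = 1) (x : Vec d) :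
    |inner ℝ x n| ≤ ‖x‖ := by
  simpa [hn] using abs_real_inner_le_norm x n

/-- The even `2`-periodic sawtooth function, equal to `|t| / 2` on `[-1, 1]`. -/
def sawtooth (t : ℝ) : ℝ := ‖(t : AddCircle (2 : ℝ))‖ / 2

theorem sawtooth_neg (t : ℝ) : sawtooth (-t) = sawtooth t := by
  simp [sawtooth]

theorem sawtooth_add_two_mul (t : ℝ) (j : ℕ) : sawtooth (t + 2 * j) = sawtooth t := by
  have : ((t + 2 * j : ℝ) : AddCircle (2 : ℝ)) = (t : AddCircle (2 : ℝ)) := by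
    rw [mul_comm, ← nsmul_eq_mul, AddCircle.coe_add, AddCircle.coe_nsmul, AddCircle.coe_period,
      smul_zero, add_zero]
  rw [sawtooth, this, sawtooth]

theorem sawtooth_sub_two_mul_int (t : ℝ) (j : ℤ) : sawtooth (t - 2 * j) = sawtooth t := by
  have : ((t - 2 * j : ℝ) : AddCircle (2 : ℝ)) = (t : AddCircle (2 : ℝ)) := by
    rw [mul_comm, ← zsmul_eq_mul, AddCircle.coe_sub, AddCircle.coe_zsmul, AddCircle.coe_period,
      smul_zero, sub_zero]
  rw [sawtooth, this, sawtooth]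

theorem sawtooth_eq_abs {t : ℝ} (ht : |t| ≤ 1) : sawtooth t = |t| / 2 := by
  rw [sawtooth, (AddCircle.norm_coe_eq_abs_iff (2 : ℝ) two_ne_zero).2 (by simpa using ht)]

theorem abs_sawtooth_le (t : ℝ) : |sawtooth t| ≤ 1 / 2 := by
  have := AddCircle.norm_le_half_period (2 : ℝ) (x := (t : AddCircle (2 : ℝ))) two_ne_zero
  rw [sawtooth, abs_of_nonneg (by positivity)]
  simp at this
  linarith

theorem abs_sawtooth_sub_le (s t : ℝ) : |sawtooth s - sawtooth t| ≤ |s - t| / 2 := by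
  rw [sawtooth, sawtooth, ← sub_div, abs_div, abs_two]
  refine div_le_div_of_nonneg_right ?_ zero_le_two
  refine (abs_norm_sub_norm_le (s : AddCircle (2 : ℝ)) (t : AddCircle (2 : ℝ))).trans ?_
  rw [← AddCircle.coe_sub]
  exact QuotientAddGroup.norm_mk_le_norm (S := AddSubgroup.zmultiples (2 : ℝ)) (m := s - t)

theorem hasDerivAt_sawtooth {t : ℝ} (ht : ∀ j : ℤ, t ≠ j) :
    HasDerivAt sawtooth (1 / 2) t ∨ HasDerivAt sawtooth (-(1 / 2)) t := by
  set j := round (t / 2)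
  have h1 : |t - 2 * j| ≤ 1 := by
    have := abs_sub_round (t / 2)
    rw [abs_le] at this ⊢
    constructor <;> linarith [this.1, this.2]
  have h2 : |t - 2 * j| ≠ 1 := by
    intro h
    rcases (abs_eq zero_le_one).1 h with h | h
    · exact ht (2 * j + 1) (by push_cast; linarith)
    · exact ht (2 * j - 1) (by push_cast; linarith)
  have h3 : t - 2 * j ≠ 0 := fun h => ht (2 * j) (by push_cast; linarith)
  have hev : sawtooth =ᶠ[𝓝 t] fun s => |s - 2 * j| / 2 := by
    have hc : Continuous fun s : ℝ => |s - 2 * j| := by fun_prop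
    filter_upwards [(hc.tendsto t).eventually_lt_const (lt_of_le_of_ne h1 h2)] with s hs
    rw [← sawtooth_sub_two_mul_int s j, sawtooth_eq_abs hs.le]
  have hsub : HasDerivAt (fun s : ℝ => s - 2 * j) 1 t := (hasDerivAt_id t).sub_const _
  rcases lt_or_gt_of_ne h3 with h | h
  · right
    have := ((hasDerivAt_abs_neg h).comp t hsub).div_const 2
    refine HasDerivAt.congr_of_eventuallyEq (f := fun s : ℝ => |s - 2 * j| / 2) ?_ hev
    exact this.congr_deriv (by norm_num)
  · left
    have := ((hasDerivAt_abs_pos h).comp t hsub).div_const 2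
    refine HasDerivAt.congr_of_eventuallyEq (f := fun s : ℝ => |s - 2 * j| / 2) ?_ hev
    exact this.congr_deriv (by norm_num)

/-- The exceptional set is a translate of the kernel of x ↦ x · n, a proper subspace. It discards
both the interface and the kinks of the laminate. -/
theorem ae_inner_ne {n : Vec d} (hn : ‖n‖ = 1) (c : ℝ) : ∀ᵐ x : Vec d, inner ℝ x n ≠ c := by
  have hker : volume ((innerSL ℝ n).ker : Set (Vec d)) = 0 := by
    refine Measure.addHaar_submodule _ _ fun h => ?_
    have : n ∈ (innerSL ℝ n).ker := h ▸ Submodule.mem_top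
    simp [hn] at this
  rw [ae_iff]
  have : {x : Vec d | ¬inner ℝ x n ≠ c} =
      (fun x => x + (-c) • n) ⁻¹' ((innerSL ℝ n).ker : Set (Vec d)) := by
    ext x
    have h1 : inner ℝ n n = (1 : ℝ) := by rw [real_inner_self_eq_norm_sq, hn, one_pow]
    simp only [not_not, mem_ofPred_eq, mem_preimage, SetLike.mem_coe, LinearMap.mem_ker,
      ContinuousLinearMap.coe_coe, innerSL_apply_apply, inner_add_right, real_inner_smul_right, h1,
      real_inner_comm x n]
    constructor <;> intro h <;> linarith
  rw [this, measure_preimage_add_right, hker]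

/-- The laminate `S(x · n) a`. -/
def laminate (a : Vec m) (n : Vec d) (x : Vec d) : Vec m := sawtooth (inner ℝ x n) • a

theorem norm_laminate_le (a : Vec m) (n x : Vec d) : ‖laminate a n x‖ ≤ ‖a‖ := by
  rw [laminate, norm_smul, Real.norm_eq_abs]
  have := abs_sawtooth_le (inner ℝ x n)
  nlinarith [norm_nonneg a]

theorem lipschitzWith_laminate (a : Vec m) {n : Vec d} (hn : ‖n‖ = 1) :
    LipschitzWith ‖a‖₊ (laminate a n) := by
  refine LipschitzWith.of_dist_le_mul fun x y => ?_
  rw [dist_eq_norm, laminate, laminate, ← sub_smul, norm_smul, Real.norm_eq_abs, coe_nnnorm,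
    mul_comm]
  gcongr
  refine (abs_sawtooth_sub_le _ _).trans ?_
  rw [← inner_sub_left, dist_eq_norm]
  have := abs_inner_le_norm_of_unit hn (x - y)
  linarith [abs_nonneg (inner ℝ (x - y) n)]

theorem laminate_neg (a : Vec m) (n x : Vec d) : laminate a n (-x) = laminate a n x := by
  rw [laminate, inner_neg_left, sawtooth_neg, laminate]

theorem fderiv_laminate_neg (a : Vec m) (n x : Vec d) :
    fderiv ℝ (laminate a n) (-x) = -fderiv ℝ (laminate a n) x := by
  have h : (fun y => laminate a n ((-1 : ℝ) • y)) = laminate a n := by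
    funext y
    rw [neg_one_smul, laminate_neg]
  have h1 := fderiv_comp_smul (𝕜 := ℝ) (f := laminate a n) (-1) (x := x)
  rw [h, neg_one_smul, neg_one_smul] at h1
  rw [h1, neg_neg]

theorem ae_fderiv_laminate (a : Vec m) {n : Vec d} (hn : ‖n‖ = 1) :
    ∀ᵐ x : Vec d, fderiv ℝ (laminate a n) x = (1 / 2 : ℝ) • tensor a n ∨
      fderiv ℝ (laminate a n) x = -((1 / 2 : ℝ) • tensor a n) := by
  have h1 : ∀ᵐ x : Vec d, ∀ j : ℤ, inner ℝ x n ≠ (j : ℝ) :=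
    ae_all_iff.2 fun j => ae_inner_ne hn j
  filter_upwards [h1] with x hx
  have hl : HasFDerivAt (fun x : Vec d => inner ℝ x n) (innerSL ℝ n) x := by
    refine (innerSL ℝ n).hasFDerivAt.congr_of_eventuallyEq (Eventually.of_forall fun y => ?_)
    rw [innerSL_apply_apply, real_inner_comm]
  have key : ∀ c : ℝ, HasDerivAt sawtooth c (inner ℝ x n) →
      fderiv ℝ (laminate a n) x = c • tensor a n := by
    intro c hc
    have h2 := (hc.comp_hasFDerivAt x hl).smul_const a
    have h3 : fderiv ℝ (laminate a n) x = _ := h2.fderiv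
    rw [h3]
    ext1 y
    simp [tensor_apply, smul_smul, real_inner_comm]
  rcases hasDerivAt_sawtooth hx with h | h
  · exact Or.inl (key _ h)
  · refine Or.inr ((key _ h).trans ?_)
    ext1 y
    simp

variable {Gp Gm : Mat d m} {a : Vec m} {n : Vec d}

theorem piecewiseAffine_eq (hK : Gp - Gm = tensor a n) (x : Vec d) :
    piecewiseAffine Gp Gm n x =
      ((1 / 2 : ℝ) • (Gp + Gm)) x + (|inner ℝ x n| / 2) • a := by
  have h : Gp x - Gm x = inner ℝ x n • a := by
    rw [← tensor_apply, ← hK, sub_apply]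
  have hp : Gp x = Gm x + inner ℝ x n • a := by rw [← h]; abel
  rw [piecewiseAffine, smul_apply, add_apply, hp]
  split_ifs with h0
  · rw [abs_of_pos h0]; module
  · rw [abs_of_nonpos (not_lt.1 h0)]; module

theorem piecewiseAffine_eq_laminate (hn : ‖n‖ = 1) (hK : Gp - Gm = tensor a n) {x : Vec d}
    (hx : x ∈ ball (0 : Vec d) 1) :
    piecewiseAffine Gp Gm n x = ((1 / 2 : ℝ) • (Gp + Gm)) x + laminate a n x := by
  have : ‖x‖ < 1 := by simpa using hx
  rw [piecewiseAffine_eq hK, laminate,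
    sawtooth_eq_abs ((abs_inner_le_norm_of_unit hn x).trans this.le)]

theorem half_add_eq (hK : Gp - Gm = tensor a n) :
    (1 / 2 : ℝ) • (Gp + Gm) + (1 / 2 : ℝ) • tensor a n = Gp ∧
      (1 / 2 : ℝ) • (Gp + Gm) + -((1 / 2 : ℝ) • tensor a n) = Gm := by
  rw [← hK]
  constructor <;> module

theorem lipschitz_piecewiseAffine (hn : ‖n‖ = 1) (hK : Gp - Gm = tensor a n) :
    ∃ K, LipschitzWith K (piecewiseAffine Gp Gm n) := by
  obtain ⟨K, hF⟩ := lipschitz_clm ((1 / 2 : ℝ) • (Gp + Gm))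
  have h1 : LipschitzWith ‖a‖₊ fun x : Vec d => (|inner ℝ x n| / 2) • a := by
    refine LipschitzWith.of_dist_le_mul fun x y => ?_
    rw [dist_eq_norm, ← sub_smul, norm_smul, Real.norm_eq_abs, coe_nnnorm, mul_comm]
    gcongr
    rw [← sub_div, abs_div, abs_two]
    have h2 := abs_abs_sub_abs_le (inner ℝ x n) (inner ℝ y n)
    rw [← inner_sub_left] at h2
    have := abs_inner_le_norm_of_unit hn (x - y)
    rw [dist_eq_norm]
    linarith [norm_nonneg (x - y)]
  exact ⟨K + ‖a‖₊, by
    simpa only [← piecewiseAffine_eq hK] using hF.add h1⟩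

/-- The ball is symmetric under x ↦ −x. The laminate correction is even and its gradient odd, so
antipodal points carry opposite phases; hence the two phases have exactly equal weight on every
centred ball and no asymptotic volume count is needed. -/
theorem setIntegral_ball_of_add_neg {f : Vec d → ℝ} {c r : ℝ} (hf : IntegrableOn f (ball 0 r))
    (h : ∀ᵐ x, f x + f (-x) = c) :
    ∫ x in ball (0 : Vec d) r, f x = c / 2 * volume.real (ball (0 : Vec d) r) := by
  have hpre : (Neg.neg : Vec d → Vec d) ⁻¹' ball 0 r = ball 0 r := by ext x; simp
  have hmp := Measure.measurePreserving_neg (volume : Measure (Vec d))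
  have hemb := (MeasurableEquiv.neg (Vec d)).measurableEmbedding
  have h1 : ∫ x in ball (0 : Vec d) r, f (-x) = ∫ x in ball (0 : Vec d) r, f x := by
    have := hmp.setIntegral_preimage_emb hemb f (ball 0 r)
    rwa [hpre] at this
  have h2 : IntegrableOn (fun x => f (-x)) (ball (0 : Vec d) r) := by
    have := (hmp.integrableOn_comp_preimage hemb (f := f) (s := ball 0 r)).2 hf
    rwa [hpre] at this
  have h3 : ∫ x in ball (0 : Vec d) r, (f x + f (-x)) = ∫ x in ball (0 : Vec d) r, c :=
    integral_congr_ae (ae_restrict_of_ae h)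
  rw [integral_add hf h2, h1, setIntegral_const, smul_eq_mul] at h3
  linarith

/-- The mean energy of a laminate on a centred ball. -/
theorem setIntegral_laminate {g : Mat d m → ℝ} (hg : Measurable g) (hb : IsBoundedOnBounded g)
    (hn : ‖n‖ = 1) (hK : Gp - Gm = tensor a n) (r : ℝ) :
    ∫ x in ball (0 : Vec d) r,
      g (fderiv ℝ (fun x => ((1 / 2 : ℝ) • (Gp + Gm)) x + laminate a n x) x) =
      (g Gp + g Gm) / 2 * volume.real (ball (0 : Vec d) r) := by
  have hL : ∃ K, LipschitzWith K (laminate a n) := ⟨_, lipschitzWith_laminate a hn⟩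
  obtain ⟨hp, hm⟩ := half_add_eq hK
  have hLu : ∃ K, LipschitzWith K fun x => ((1 / 2 : ℝ) • (Gp + Gm)) x + laminate a n x :=
    ⟨_, ((1 / 2 : ℝ) • (Gp + Gm)).lipschitz.add (lipschitzWith_laminate a hn)⟩
  refine setIntegral_ball_of_add_neg (integrableOn_ball_comp_fderiv hg hb hLu _ _) ?_
  have hae := ae_fderiv_clm_add ((1 / 2 : ℝ) • (Gp + Gm)) hL
  have hae' := (Measure.measurePreserving_neg (volume : Measure (Vec d))
    ).quasiMeasurePreserving.ae hae
  filter_upwards [hae, hae', ae_fderiv_laminate a hn] with x h1 h2 h3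
  rw [h1, h2, fderiv_laminate_neg]
  rcases h3 with h3 | h3
  · rw [h3, hp, hm]
  · rw [h3, neg_neg, hp, hm, add_comm]

theorem setIntegral_fderiv_congr (g : Mat d m → ℝ) {u v : Vec d → Vec m} {s : Set (Vec d)}
    (hs : IsOpen s) (h : EqOn u v s) :
    ∫ x in s, g (fderiv ℝ u x) = ∫ x in s, g (fderiv ℝ v x) := by
  refine setIntegral_congr_fun hs.measurableSet fun x hx => ?_
  have : u =ᶠ[𝓝 x] v := h.eventuallyEq_of_mem (hs.mem_nhds hx)
  simp only [this.fderiv_eq]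

theorem setIntegral_piecewiseAffine {g : Mat d m → ℝ} (hg : Measurable g)
    (hb : IsBoundedOnBounded g) (hn : ‖n‖ = 1) (hK : Gp - Gm = tensor a n) :
    ∫ x in ball (0 : Vec d) 1, g (fderiv ℝ (piecewiseAffine Gp Gm n) x) =
      (g Gp + g Gm) / 2 * volume.real (ball (0 : Vec d) 1) := by
  rw [← setIntegral_laminate hg hb hn hK 1]
  exact setIntegral_fderiv_congr g isOpen_ball fun x hx => piecewiseAffine_eq_laminate hn hK hx

/-! ### Laminates with defects inserted at the interfaces. -/

theorem IsVariation.translate {φ : Vec d → Vec m} (hφ : IsVariation (ball 0 1) φ) (c : Vec d) :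
    IsVariation (ball c 1) (fun x => φ (x - c)) := by
  simpa using hφ.rescale c one_pos

theorem exists_orthonormalBasis_extending (hn : ‖n‖ = 1) :
    ∃ (b : OrthonormalBasis (Fin d) ℝ (Vec d)) (i : Fin d), b i = n := by
  have hd : 0 < d := by
    rcases Nat.eq_zero_or_pos d with rfl | h
    · simp [Subsingleton.elim n 0] at hn
    · exact h
  let i : Fin d := ⟨0, hd⟩
  obtain ⟨b, hb⟩ := Orthonormal.exists_orthonormalBasis_extension_of_card_eq (𝕜 := ℝ)
    (E := Vec d) (ι := Fin d) (by simp) (v := fun _ => n) (s := {i})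
    (by
      rw [orthonormal_iff_ite]
      rintro ⟨j, rfl⟩ ⟨k, rfl⟩
      simp [hn])
  exact ⟨b, i, hb i rfl⟩

/-- Points of a cubic lattice adapted to the normal `n`. -/
theorem exists_lattice_points (hn : ‖n‖ = 1) (N : ℕ) :
    ∃ k : (Fin d → Fin N) → Vec d, (∀ j, ∃ l : ℕ, inner ℝ (k j) n = 2 * l) ∧
      (∀ j, ‖k j‖ ≤ 2 * N * d) ∧ ∀ i j, i ≠ j → 2 ≤ dist (k i) (k j) := by
  obtain ⟨b, i₀, hb⟩ := exists_orthonormalBasis_extending hn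
  have hinner : ∀ (c : Fin d → ℝ) (i : Fin d), inner ℝ (∑ l, c l • b l) (b i) = c i := by
    intro c i
    rw [real_inner_comm, b.orthonormal.inner_right_fintype]
  -- Spacing 2 keeps unit balls disjoint. It is also the period of the sawtooth, and n is a basis
  -- vector, so every lattice point lies on an interface with the same orientation as the one
  -- through 0.
  refine ⟨fun j => ∑ i, (2 * (j i : ℕ) : ℝ) • b i, fun j => ⟨j i₀, ?_⟩, fun j => ?_,
    fun i j hij => ?_⟩
  · rw [← hb, hinner]
  · refine (norm_sum_le _ _).trans ?_
    calc ∑ i, ‖(2 * (j i : ℕ) : ℝ) • b i‖ ≤ ∑ _i : Fin d, (2 * N : ℝ) := by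
          refine Finset.sum_le_sum fun i _ => ?_
          have h1 : ((j i : ℕ) : ℝ) ≤ N := by exact_mod_cast (j i).2.le
          rw [norm_smul, b.norm_eq_one, mul_one, Real.norm_of_nonneg (by positivity)]
          linarith
      _ = 2 * N * d := by simp [mul_comm]
  · obtain ⟨l, hl⟩ := Function.ne_iff.1 hij
    have h1 : inner ℝ (∑ i', (2 * (i i' : ℕ) : ℝ) • b i' - ∑ i', (2 * (j i' : ℕ) : ℝ) • b i') (b l)
        = 2 * ((i l : ℕ) : ℝ) - 2 * ((j l : ℕ) : ℝ) := by
      rw [inner_sub_left, hinner, hinner]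
    have h2 := abs_inner_le_norm_of_unit (b.norm_eq_one l)
      (∑ i', (2 * (i i' : ℕ) : ℝ) • b i' - ∑ i', (2 * (j i' : ℕ) : ℝ) • b i')
    rw [h1, ← dist_eq_norm] at h2
    refine le_trans ?_ h2
    have h3 : (1 : ℝ) ≤ |((i l : ℕ) : ℝ) - ((j l : ℕ) : ℝ)| := by
      have : (1 : ℤ) ≤ |((i l : ℕ) : ℤ) - ((j l : ℕ) : ℤ)| :=
        Int.one_le_abs (by
          rw [sub_ne_zero]
          exact_mod_cast fun h => hl (Fin.ext h))
      exact_mod_cast this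
    rw [← mul_sub, abs_mul, abs_two]
    linarith

/-- Energy of a laminate in a ball of radius `2 N d + 2` with `N ^ d` unit balls, centred on
interfaces, in which the variation `φ` is inserted. -/
theorem IsQuasiconvexAt.le_laminate_with_defects {g : Mat d m → ℝ} (hg : Measurable g)
    (hb : IsBoundedOnBounded g) (hn : ‖n‖ = 1) (hK : Gp - Gm = tensor a n)
    (hq : IsQuasiconvexAt g ((1 / 2 : ℝ) • (Gp + Gm))) {φ : Vec d → Vec m}
    (hφ : IsVariation (ball 0 1) φ) {C : ℝ}
    (hC : ∀ F, ‖F‖ ≤ ‖(1 / 2 : ℝ) • (Gp + Gm)‖ + (‖a‖ + ‖a‖) → |g F| ≤ C) (N : ℕ) {R : ℝ}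
    (hR : R = 2 * N * d + 2) :
    g ((1 / 2 : ℝ) • (Gp + Gm)) * volume.real (ball (0 : Vec d) R) ≤
      (g Gp + g Gm) / 2 * volume.real (ball (0 : Vec d) (R - 1)) +
        C * (volume.real (ball (0 : Vec d) R) - volume.real (ball (0 : Vec d) (R - 1))) +
        N ^ d * ((∫ x in ball (0 : Vec d) 1,
          g (fderiv ℝ (fun x => piecewiseAffine Gp Gm n x + φ x) x)) -
          ∫ x in ball (0 : Vec d) 1, g (fderiv ℝ (piecewiseAffine Gp Gm n) x)) := by
  set F := (1 / 2 : ℝ) • (Gp + Gm) with hF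
  have hR1 : 0 < R - 1 := by rw [hR]; ring_nf; positivity
  have hR0 : 0 < R := by linarith
  obtain ⟨k, hkn, hkR, hkd⟩ := exists_lattice_points hn N
  -- With δ = 1/R the transition shell has width 1. Its slope multiplies a laminate bounded by ‖a‖,
  -- so the gradient bound grows by ‖a‖ only, uniformly in N.
  set η := radialCutoff (0 : Vec d) (1 / R) R
  have hη1 : ∀ x ∈ ball (0 : Vec d) (R - 1), η x = 1 := fun x hx =>
    radialCutoff_eq_one (by positivity) hR0 (by
      rw [sub_mul, div_mul_cancel₀ _ hR0.ne', one_mul]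
      exact (mem_ball.1 hx).le)
  have hψL := lipschitzWith_radialCutoff_smul (z := (0 : Vec d)) (δ := 1 / R) (by positivity) hR0
    (lipschitzWith_laminate a hn) (fun x _ => norm_laminate_le a n x)
  rw [div_mul_cancel₀ _ hR0.ne', div_one] at hψL
  set ψ : Vec d → Vec m := fun x => η x • laminate a n x
  have hψ : IsVariation (ball 0 R) ψ := ⟨⟨_, hψL⟩, fun x hx => by
    simp only [ψ, η, radialCutoff_eq_zero (show 0 < 1 / R by positivity) hR0 hx, zero_smul]⟩
  have huL := F.lipschitz.add hψL
  set u : Vec d → Vec m := fun x => F x + ψ x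
  have hball : ∀ j, ball (k j) 1 ⊆ ball (0 : Vec d) (R - 1) := fun j => by
    refine ball_subset_ball' ?_
    rw [dist_zero_right]
    linarith [hkR j]
  have hball' : ball (0 : Vec d) (R - 1) ⊆ ball 0 R := ball_subset_ball (by linarith)
  have hw : ∀ j ∈ (Finset.univ : Finset (Fin d → Fin N)),
      IsVariation (ball (k j) 1) fun x => φ (x - k j) := fun j _ => hφ.translate (k j)
  have htest := hq.le_integral 0 hR0 (hψ.add (IsVariation.sum Finset.univ fun j hj =>
    (hw j hj).mono ((hball j).trans hball')))
  have hassoc : (fun x => F x + (ψ x + ∑ j : Fin d → Fin N, φ (x - k j))) =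
      fun x => u x + ∑ j : Fin d → Fin N, φ (x - k j) := by
    ext1 x; simp only [u, add_assoc]
  rw [hassoc, setIntegral_add_sum_variations hg hb ⟨_, huL⟩ Finset.univ (fun _ _ => one_pos) hw
    (fun i _ j _ hij => ball_disjoint_ball (by linarith [hkd i j hij]))
    (fun j _ => (hball j).trans hball') measurableSet_ball measure_ball_lt_top.ne] at htest
  have hdef : ∀ j ∈ (Finset.univ : Finset (Fin d → Fin N)),
      ((∫ x in ball (k j) 1, g (fderiv ℝ (fun x => u x + φ (x - k j)) x)) -
        ∫ x in ball (k j) 1, g (fderiv ℝ u x)) =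
      (∫ x in ball (0 : Vec d) 1,
          g (fderiv ℝ (fun x => piecewiseAffine Gp Gm n x + φ x) x)) -
          ∫ x in ball (0 : Vec d) 1, g (fderiv ℝ (piecewiseAffine Gp Gm n) x) := by
    intro j _
    -- Up to an additive constant, the laminate around each lattice point is a translate of the
    -- broken affine map, so all defects contribute the same energy difference.
    have hu : ∀ x ∈ ball (0 : Vec d) 1, u (k j + x) = F (k j) + piecewiseAffine Gp Gm n x := by
      intro x hx
      obtain ⟨l, hl⟩ := hkn j
      have h1 : k j + x ∈ ball (0 : Vec d) (R - 1) := hball j (by simpa using hx)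
      simp only [u, ψ, hη1 _ h1, one_smul, map_add]
      rw [piecewiseAffine_eq_laminate hn hK hx, laminate, inner_add_left, hl, add_comm (2 * (l : ℝ)),
        sawtooth_add_two_mul, laminate, add_assoc]
    rw [gradEnergy_rescale g _ (k j) one_pos, gradEnergy_rescale g u (k j) one_pos]
    simp only [one_pow, one_mul, inv_one, one_smul]
    congr 1
    · rw [setIntegral_fderiv_congr g isOpen_ball
        (v := fun x => F (k j) + (piecewiseAffine Gp Gm n x + φ x))]
      · simp only [fderiv_const_add]
      · intro x hx
        simp only [hu x hx, add_sub_cancel_left, add_assoc]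
    · rw [setIntegral_fderiv_congr g isOpen_ball
        (v := fun x => F (k j) + piecewiseAffine Gp Gm n x)]
      · simp only [fderiv_const_add]
      · exact hu
  rw [Finset.sum_congr rfl hdef, Finset.sum_const, Finset.card_univ, nsmul_eq_mul] at htest
  simp only [Fintype.card_pi, Fintype.card_fin, Finset.prod_const, Finset.card_univ,
    Nat.cast_pow] at htest
  have hshell := setIntegral_ball_le_of_shell (z := (0 : Vec d)) hR1 (by linarith)
    (integrableOn_ball_comp_fderiv hg hb ⟨_, huL⟩ 0 R) (C := C) (fun x _ =>
      (le_abs_self _).trans (hC _ ((norm_fderiv_le_of_lipschitz ℝ huL).trans (by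
        push_cast
        rw [Real.coe_toNNReal _ (norm_nonneg a)]))))
  rw [setIntegral_fderiv_congr g (s := ball 0 (R - 1)) isOpen_ball
    (v := fun x => F x + laminate a n x) (fun x hx => by simp only [u, ψ, hη1 x hx, one_smul]),
    setIntegral_laminate hg hb hn hK] at hshell
  linarith

/-- If `g` is quasiconvex at the mean of two rank-one connected matrices, then perturbing the
interface between them gains no more than the convexity defect of `g`. -/
theorem IsQuasiconvexAt.le_laminate {g : Mat d m → ℝ} (hg : Measurable g)
    (hb : IsBoundedOnBounded g) (hn : ‖n‖ = 1) (hK : Gp - Gm = tensor a n)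
    (hq : IsQuasiconvexAt g ((1 / 2 : ℝ) • (Gp + Gm))) {φ : Vec d → Vec m}
    (hφ : IsVariation (ball 0 1) φ) :
    g ((1 / 2 : ℝ) • (Gp + Gm)) ≤ (g Gp + g Gm) / 2 + (1 / (2 * d)) ^ d *
      (((∫ x in ball (0 : Vec d) 1,
          g (fderiv ℝ (fun x => piecewiseAffine Gp Gm n x + φ x) x)) -
          ∫ x in ball (0 : Vec d) 1, g (fderiv ℝ (piecewiseAffine Gp Gm n) x)) /
        volume.real (ball (0 : Vec d) 1)) := by
  obtain ⟨C, hC⟩ := hb (‖(1 / 2 : ℝ) • (Gp + Gm)‖ + (‖a‖ + ‖a‖))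
  set Δ := (∫ x in ball (0 : Vec d) 1,
          g (fderiv ℝ (fun x => piecewiseAffine Gp Gm n x + φ x) x)) -
          ∫ x in ball (0 : Vec d) 1, g (fderiv ℝ (piecewiseAffine Gp Gm n) x) with hΔ
  set V := volume.real (ball (0 : Vec d) 1) with hV
  have hV0 : 0 < V := volume_real_ball_pos _ one_pos
  have hd : 0 < d := by
    rcases Nat.eq_zero_or_pos d with rfl | h
    · simp [Subsingleton.elim n 0] at hn
    · exact h
  have hd' : (0 : ℝ) < d := by exact_mod_cast hd
  set R : ℕ → ℝ := fun N => 2 * N * d + 2 with hR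
  have hR0 : ∀ N, 1 < R N := fun N => by
    have : (0 : ℝ) ≤ 2 * N * d := by positivity
    simp only [hR]; linarith
  -- The estimate divided by R^d |B|. Since R − 2 = 2Nd, the defect density is N/R = (1 − 2/R)/(2d)
  -- to the power d; it stays positive in the limit while the shell fraction vanishes.
  have hstep : ∀ N : ℕ, g ((1 / 2 : ℝ) • (Gp + Gm)) ≤ (g Gp + g Gm) / 2 * (1 - (R N)⁻¹) ^ d +
      C * (1 - (1 - (R N)⁻¹) ^ d) + (1 / (2 * d) * (1 - 2 * (R N)⁻¹)) ^ d * (Δ / V) := by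
    intro N
    have h0 : 0 < R N := by linarith [hR0 N]
    have h := hq.le_laminate_with_defects hg hb hn hK hφ hC N (R := R N) rfl
    rw [volume_real_ball 0 h0, volume_real_ball (r := R N - 1) 0 (by linarith [hR0 N]), ← hV,
      ← hΔ] at h
    have e1 : (R N - 1) ^ d = R N ^ d * (1 - (R N)⁻¹) ^ d := by
      rw [← mul_pow, mul_sub, mul_one, mul_inv_cancel₀ h0.ne']
    have e2 : (N : ℝ) ^ d = R N ^ d * (1 / (2 * d) * (1 - 2 * (R N)⁻¹)) ^ d := by
      rw [← mul_pow]
      congr 1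
      have : R N = 2 * N * d + 2 := rfl
      field_simp
      rw [this]; ring
    rw [e1, e2] at h
    refine le_of_mul_le_mul_right (h.trans_eq ?_) (mul_pos (pow_pos h0 d) hV0)
    field_simp
  have hRinf : Tendsto (fun N => (R N)⁻¹) atTop (𝓝 0) := by
    refine tendsto_inv_atTop_zero.comp ?_
    refine tendsto_atTop_add_const_right _ _ ?_
    refine Tendsto.atTop_mul_const hd' ?_
    exact Tendsto.const_mul_atTop two_pos tendsto_natCast_atTop_atTop
  have hcont : Continuous fun t : ℝ => (g Gp + g Gm) / 2 * (1 - t) ^ d +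
      C * (1 - (1 - t) ^ d) + (1 / (2 * d) * (1 - 2 * t)) ^ d * (Δ / V) := by fun_prop
  have hlim := (hcont.tendsto 0).comp hRinf
  refine (ge_of_tendsto' hlim hstep).trans_eq ?_
  simp

/-- Rank-one midpoint convexity. -/
theorem IsQuasiconvexAt.le_midpoint {g : Mat d m → ℝ} (hg : Measurable g)
    (hb : IsBoundedOnBounded g) (hn : ‖n‖ = 1) (hK : Gp - Gm = tensor a n)
    (hq : IsQuasiconvexAt g ((1 / 2 : ℝ) • (Gp + Gm))) :
    g ((1 / 2 : ℝ) • (Gp + Gm)) ≤ (g Gp + g Gm) / 2 := by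
  simpa using hq.le_laminate hg hb hn hK (IsVariation.zero _)

/-! ### Rank-one tangents and sufficiency. -/

theorem mat_zero_smul (X : Mat d m) : (0 : ℝ) • X = 0 := by
  ext1 x
  simp

/-- A quasiconvex function below `W` that touches `W` at `F` lies above the tangent of `W` at `F`
in rank-one directions. -/
theorem tangent_le_of_quasiconvexAt {Z W : Mat d m → ℝ} (hZ : Measurable Z)
    (hb : IsBoundedOnBounded Z) (hq : ∀ F, IsQuasiconvexAt Z F) (hZW : ∀ F, Z F ≤ W F)
    (hn : ‖n‖ = 1) {F : Mat d m} (hF : Z F = W F) {P : Mat d m →L[ℝ] ℝ}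
    (hP : HasFDerivAt W P F) (b : Vec m) :
    W F + P (tensor b n) ≤ Z (F + tensor b n) := by
  set T := tensor b n with hT
  have hts : ∀ c : ℝ, tensor (c • b) n = c • T := fun c => by
    ext1 x
    simp [tensor_apply, hT, smul_smul, mul_comm]
  have hmid : ∀ s t : ℝ, Z (F + ((s + t) / 2) • T) ≤ (Z (F + s • T) + Z (F + t • T)) / 2 := by
    intro s t
    have h1 : (F + s • T) - (F + t • T) = tensor ((s - t) • b) n := by
      rw [hts]; module
    have h2 := (hq _).le_midpoint hZ hb hn h1
    have h3 : (1 / 2 : ℝ) • ((F + s • T) + (F + t • T)) = F + ((s + t) / 2) • T := by module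
    rwa [h3] at h2
  -- Repeated halving gives convexity at the points 2^(-k), which is enough here; no continuity of Z
  -- is used.
  have hdy : ∀ k : ℕ, Z (F + ((1 / 2 : ℝ) ^ k) • T) ≤
      (1 - (1 / 2) ^ k) * Z F + (1 / 2) ^ k * Z (F + T) := by
    intro k
    induction k with
    | zero => simp
    | succ k ih =>
      have h := hmid ((1 / 2) ^ k) 0
      rw [mat_zero_smul, add_zero, add_zero, show ((1 / 2 : ℝ) ^ k) / 2 = (1 / 2) ^ (k + 1) by
        rw [pow_succ]; ring] at h
      refine h.trans ?_
      rw [pow_succ]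
      linarith
  have hw : HasDerivAt (fun s : ℝ => W (F + s • T)) (P T) 0 := by
    have h1 : HasDerivAt (fun s : ℝ => F + s • T) T 0 := by
      simpa using ((hasDerivAt_id (0 : ℝ)).smul_const T).const_add F
    have h2 : HasFDerivAt W P (F + (0 : ℝ) • T) := by
      rwa [mat_zero_smul, add_zero]
    exact h2.comp_hasDerivAt 0 h1
  -- The derivative is computed from the side opposite to T. The midpoint inequality at F gives Z(F
  -- − tT) ≥ 2Z(F) − Z(F + tT), and W ≥ Z turns this into an upper bound for the slope of W at
  -- negative increments; at positive increments W ≥ Z would bound it from the wrong side.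
  have hseq : Tendsto (fun k : ℕ => -((1 / 2 : ℝ) ^ k)) atTop (𝓝[≠] 0) := by
    refine tendsto_nhdsWithin_iff.2 ⟨?_, Eventually.of_forall fun k => by simp⟩
    simpa using (tendsto_pow_atTop_nhds_zero_of_lt_one (by norm_num : (0 : ℝ) ≤ 1 / 2)
      (by norm_num)).neg
  have hlim := (hasDerivAt_iff_tendsto_slope_zero.1 hw).comp hseq
  have hle : P T ≤ Z (F + T) - Z F := by
    refine le_of_tendsto' hlim fun k => ?_
    simp only [Function.comp, zero_add, mat_zero_smul, add_zero, smul_eq_mul]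
    set t := (1 / 2 : ℝ) ^ k with ht
    have ht0 : 0 < t := by positivity
    have h1 := hmid t (-t)
    rw [add_neg_cancel, zero_div, mat_zero_smul, add_zero] at h1
    have h2 := hdy k
    have h3 := hZW (F + (-t) • T)
    rw [inv_neg, neg_mul, ← mul_neg, inv_mul_eq_div, div_le_iff₀ ht0]
    rw [hF] at *
    nlinarith
  rw [← hF]
  linarith

/-- Sufficiency: material stability and interchange stability imply global minimality. -/
theorem energy_piecewiseAffine_le {W : Mat d m → ℝ} (hW : Continuous W)
    (hbd : BddBelow (range W)) (hn : ‖n‖ = 1) (hK : Gp - Gm = tensor a n)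
    (hp : IsQuasiconvexAt W Gp) (hm : IsQuasiconvexAt W Gm) {P Q : Mat d m →L[ℝ] ℝ}
    (hP : HasFDerivAt W P Gp) (hQ : HasFDerivAt W Q Gm) (hI : (P - Q) (tensor a n) ≤ 0)
    {φ : Vec d → Vec m} (hφ : IsVariation (ball 0 1) φ) :
    ∫ x in ball (0 : Vec d) 1, W (fderiv ℝ (piecewiseAffine Gp Gm n) x) ≤
      ∫ x in ball (0 : Vec d) 1, W (fderiv ℝ (fun x => piecewiseAffine Gp Gm n x + φ x) x) := by
  set Z := relaxation W
  have hZm : Measurable Z := measurable_relaxation hW hbd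
  have hZb : IsBoundedOnBounded Z := isBoundedOnBounded_relaxation hW hbd
  have hZq := isQuasiconvexAt_relaxation hW hbd
  have hZW : ∀ F, Z F ≤ W F := relaxation_le hW hbd
  have hZp : Z Gp = W Gp := le_antisymm (hZW _) hp.le_relaxation
  have hZm' : Z Gm = W Gm := le_antisymm (hZW _) hm.le_relaxation
  have ht : ∀ c : ℝ, tensor (c • a) n = c • tensor a n := fun c => by
    ext1 x
    simp [tensor_apply, smul_smul, mul_comm]
  -- Half a jump back from G₊ and half a jump forward from G₋ reach the same midpoint, so both
  -- tangents bound Z there.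
  have h1 := tangent_le_of_quasiconvexAt hZm hZb hZq hZW hn hZp hP ((-(1 / 2) : ℝ) • a)
  have h2 := tangent_le_of_quasiconvexAt hZm hZb hZq hZW hn hZm' hQ ((1 / 2 : ℝ) • a)
  rw [ht, map_smul, show Gp + (-(1 / 2) : ℝ) • tensor a n = (1 / 2 : ℝ) • (Gp + Gm) by
    rw [← hK]; module, smul_eq_mul] at h1
  rw [ht, map_smul, show Gm + (1 / 2 : ℝ) • tensor a n = (1 / 2 : ℝ) • (Gp + Gm) by
    rw [← hK]; module, smul_eq_mul] at h2
  have h3 := (hZq ((1 / 2 : ℝ) • (Gp + Gm))).le_laminate hZm hZb hn hK hφ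
  rw [setIntegral_piecewiseAffine hZm hZb hn hK] at h3
  rw [setIntegral_piecewiseAffine hW.measurable (isBoundedOnBounded_of_continuous hW) hn hK]
  have hL := hφ.lipschitz_add (lipschitz_piecewiseAffine hn hK)
  have h4 : ∫ x in ball (0 : Vec d) 1,
      Z (fderiv ℝ (fun x => piecewiseAffine Gp Gm n x + φ x) x) ≤
      ∫ x in ball (0 : Vec d) 1, W (fderiv ℝ (fun x => piecewiseAffine Gp Gm n x + φ x) x) :=
    setIntegral_mono (integrableOn_ball_comp_fderiv hZm hZb hL _ _)
      (integrableOn_ball_comp_fderiv hW.measurable (isBoundedOnBounded_of_continuous hW) hL _ _)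
      fun z => hZW _
  refine le_trans ?_ h4
  rw [sub_apply] at hI
  rw [hZp, hZm'] at h3
  have h5 : 0 ≤ (1 / (2 * (d : ℝ))) ^ d * (((∫ x in ball (0 : Vec d) 1,
      Z (fderiv ℝ (fun x => piecewiseAffine Gp Gm n x + φ x) x)) -
      (W Gp + W Gm) / 2 * volume.real (ball (0 : Vec d) 1)) /
      volume.real (ball (0 : Vec d) 1)) := by linarith
  have hd : 0 < d := by
    rcases Nat.eq_zero_or_pos d with rfl | h
    · simp [Subsingleton.elim n 0] at hn
    · exact h
  have hd' : (0 : ℝ) < d := by exact_mod_cast hd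
  have h6 := nonneg_of_mul_nonneg_right h5 (by positivity)
  rw [le_div_iff₀ (volume_real_ball_pos (0 : Vec d) one_pos), zero_mul] at h6
  linarith

/-! ### Stability under Lipschitz variations and necessity of quasiconvexity. -/

/-- The energy of the broken affine map does not decrease under Lipschitz variations. -/
def IsStableUnderVariations (W : Mat d m → ℝ) (Gp Gm : Mat d m) (n : Vec d) : Prop :=
  ∀ φ : Vec d → Vec m, IsVariation (ball 0 1) φ →
    ∫ x in ball (0 : Vec d) 1, W (fderiv ℝ (piecewiseAffine Gp Gm n) x) ≤
      ∫ x in ball (0 : Vec d) 1, W (fderiv ℝ (fun x => piecewiseAffine Gp Gm n x + φ x) x)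

/-- The difference between a competitor and the broken affine map vanishes on the sphere, so it
extends by zero to a variation; the energy sees only the open ball, where nothing changes. -/
theorem isInterfaceMinimizer_iff [Nontrivial (Vec d)] {W : Mat d m → ℝ} (hn : ‖n‖ = 1)
    (hK : Gp - Gm = tensor a n) :
    IsInterfaceMinimizer W Gp Gm n ↔ IsStableUnderVariations W Gp Gm n := by
  obtain ⟨K, hL⟩ := lipschitz_piecewiseAffine hn hK
  constructor
  · rintro ⟨-, h⟩ φ hφ
    refine isMinOn_iff.1 h _ ⟨?_, fun z hz => ?_⟩
    · obtain ⟨M, hM⟩ := hφ.lipschitz_add ⟨K, hL⟩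
      exact ⟨M, hM.lipschitzOnWith⟩
    · simp only [hφ.mem_lipschitzClass.2 z hz, add_zero]
  · intro h
    refine ⟨⟨⟨K, hL.lipschitzOnWith⟩, fun _ _ => rfl⟩, isMinOn_iff.2 fun y hy => ?_⟩
    obtain ⟨⟨M, hM⟩, hy0⟩ := hy
    have hφ : (fun x => y x - piecewiseAffine Gp Gm n x) ∈
        lipschitzClass (fun _ : Vec d => (0 : Vec m)) :=
      ⟨⟨M + K, hM.sub hL.lipschitzOnWith⟩, fun z hz => by simp only [hy0 z hz, sub_self]⟩
    obtain ⟨ψ, hψ, he⟩ := exists_zero_extension hφ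
    refine (h ψ hψ).trans_eq (setIntegral_fderiv_congr W isOpen_ball fun x hx => ?_)
    rw [← he (ball_subset_closedBall hx), add_sub_cancel]

/-- Stability localizes to quasiconvexity at a matrix `G` wherever the gradient equals `G`. -/
theorem IsStableUnderVariations.isQuasiconvexAt_of_eqOn {W : Mat d m → ℝ} (hW : Continuous W)
    (hn : ‖n‖ = 1) (hK : Gp - Gm = tensor a n) (hs : IsStableUnderVariations W Gp Gm n)
    {G : Mat d m} {c : Vec d} {r : ℝ} (hr : 0 < r) (hsub : ball c r ⊆ ball 0 1)
    (hG : EqOn (piecewiseAffine Gp Gm n) G (ball c r)) : IsQuasiconvexAt W G := by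
  intro φ hφ
  have hw := hφ.rescale c hr
  have h := hs _ (hw.mono hsub)
  have hrep := setIntegral_add_sum_variations hW.measurable (isBoundedOnBounded_of_continuous hW)
    (lipschitz_piecewiseAffine hn hK) {()} (c := fun _ => c) (r := fun _ => r) (fun _ _ => hr)
    (w := fun _ x => r • φ (r⁻¹ • (x - c))) (fun _ _ => hw) (by simp)
    (D := ball (0 : Vec d) 1) (fun _ _ => hsub) measurableSet_ball measure_ball_lt_top.ne
  simp only [Finset.sum_singleton] at hrep
  rw [hrep] at h
  have h1 : ∫ x in ball c r, W (fderiv ℝ (piecewiseAffine Gp Gm n) x) =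
      W G * volume.real (ball c r) := by
    rw [setIntegral_fderiv_congr W isOpen_ball hG]
    simp only [ContinuousLinearMap.fderiv, setIntegral_const, smul_eq_mul, mul_comm]
  have h2 : ∫ x in ball c r, W (fderiv ℝ
      (fun x => piecewiseAffine Gp Gm n x + r • φ (r⁻¹ • (x - c))) x) =
      r ^ d * ∫ x in ball (0 : Vec d) 1, W (fderiv ℝ (fun x => G x + φ x) x) := by
    rw [setIntegral_fderiv_congr W isOpen_ball (v := fun x => G x + r • φ (r⁻¹ • (x - c)))
      fun x hx => by simp only [hG hx], gradEnergy_rescale W _ c hr]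
    have h3 : (fun x => r⁻¹ • (G (c + r • x) + r • φ (r⁻¹ • ((c + r • x) - c)))) =
        fun x => r⁻¹ • G c + (G x + φ x) := by
      ext1 x
      simp only [add_sub_cancel_left, map_add, map_smul, smul_add, smul_smul,
        inv_mul_cancel₀ hr.ne', one_smul, add_assoc]
    rw [h3]
    simp only [fderiv_const_add]
  rw [h1, h2, volume_real_ball c hr] at h
  refine le_of_mul_le_mul_left ?_ (pow_pos hr d)
  linarith

theorem ball_half_subset (hn : ‖n‖ = 1) {c : Vec d} (hc : c = (1 / 2 : ℝ) • n ∨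
    c = -((1 / 2 : ℝ) • n)) : ball c (1 / 2) ⊆ ball 0 1 := by
  refine ball_subset_ball' ?_
  rw [dist_zero_right]
  rcases hc with rfl | rfl
  · rw [norm_smul, hn]; norm_num
  · rw [norm_neg, norm_smul, hn]; norm_num

/-- The balls of radius 1/2 about n/2 and −n/2 lie on either side of the interface inside the unit
ball, where the gradient is constant. -/
theorem IsStableUnderVariations.isQuasiconvexAt {W : Mat d m → ℝ} (hW : Continuous W)
    (hn : ‖n‖ = 1) (hK : Gp - Gm = tensor a n) (hs : IsStableUnderVariations W Gp Gm n) :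
    IsQuasiconvexAt W Gp ∧ IsQuasiconvexAt W Gm := by
  have hnn : inner ℝ n n = (1 : ℝ) := by rw [real_inner_self_eq_norm_sq, hn, one_pow]
  have key : ∀ (c x : Vec d), x ∈ ball c (1 / 2) →
      |inner ℝ x n - inner ℝ c n| < (1 / 2 : ℝ) := by
    intro c x hx
    rw [← inner_sub_left]
    exact (abs_inner_le_norm_of_unit hn _).trans_lt (by rwa [← dist_eq_norm])
  constructor
  · refine hs.isQuasiconvexAt_of_eqOn hW hn hK one_half_pos (ball_half_subset hn (Or.inl rfl))
      fun x hx => ?_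
    have h := key _ x hx
    rw [real_inner_smul_left, hnn, abs_lt] at h
    rw [piecewiseAffine, if_pos (by linarith [h.1])]
  · refine hs.isQuasiconvexAt_of_eqOn hW hn hK one_half_pos (ball_half_subset hn (Or.inr rfl))
      fun x hx => ?_
    have h := key _ x hx
    rw [inner_neg_left, real_inner_smul_left, hnn, abs_lt] at h
    rw [piecewiseAffine, if_neg (by linarith [h.2])]

/-! ### First variation and necessity of interchange stability. -/

/-- The bump `1 - |x|²`, extended by zero off the unit ball. -/
def paraboloid (x : Vec d) : ℝ := 1 - (min ‖x‖ 1) ^ 2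

theorem isVariation_paraboloid (b : Vec m) :
    IsVariation (ball (0 : Vec d) 1) fun x => paraboloid x • b := by
  refine ⟨⟨2 * ‖b‖₊, LipschitzWith.of_dist_le_mul fun x y => ?_⟩, fun z hz => ?_⟩
  · rw [dist_eq_norm, ← sub_smul, norm_smul, Real.norm_eq_abs]
    have h1 : |min ‖y‖ 1 - min ‖x‖ 1| ≤ dist x y := by
      refine (abs_min_sub_min_le_max _ _ _ _).trans (max_le ?_ (by simp))
      rw [dist_comm, dist_eq_norm]
      exact abs_norm_sub_norm_le y x
    have h2 : |min ‖y‖ 1 + min ‖x‖ 1| ≤ 2 := by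
      rw [abs_of_nonneg (by positivity)]
      linarith [min_le_right ‖y‖ 1, min_le_right ‖x‖ 1]
    have h3 : |paraboloid x - paraboloid y| ≤ 2 * dist x y := by
      rw [paraboloid, paraboloid, show 1 - min ‖x‖ 1 ^ 2 - (1 - min ‖y‖ 1 ^ 2) =
        (min ‖y‖ 1 + min ‖x‖ 1) * (min ‖y‖ 1 - min ‖x‖ 1) by ring, abs_mul]
      exact mul_le_mul h2 h1 (abs_nonneg _) zero_le_two
    calc _ ≤ 2 * dist x y * ‖b‖ := by gcongr
      _ = _ := by push_cast; ring
  · have : 1 ≤ ‖z‖ := by simpa using hz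
    simp [paraboloid, min_eq_right this]

theorem hasFDerivAt_paraboloid (b : Vec m) {x : Vec d} (hx : x ∈ ball (0 : Vec d) 1) :
    HasFDerivAt (fun x => paraboloid x • b) ((-2 : ℝ) • tensor b x) x := by
  have h1 : HasFDerivAt (fun x : Vec d => 1 - ‖x‖ ^ 2) (-(2 • innerSL ℝ x)) x :=
    (hasStrictFDerivAt_norm_sq x).hasFDerivAt.const_sub 1
  have h2 : (paraboloid : Vec d → ℝ) =ᶠ[𝓝 x] fun x => 1 - ‖x‖ ^ 2 := by
    filter_upwards [isOpen_ball.mem_nhds hx] with y hy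
    have : ‖y‖ < 1 := by simpa using hy
    rw [paraboloid, min_eq_left this.le]
  refine ((h1.congr_of_eventuallyEq h2).smul_const b).congr_fderiv ?_
  ext1 y
  simp [tensor_apply, smul_smul, real_inner_comm]

theorem norm_tensor_le (b : Vec m) (x : Vec d) : ‖tensor b x‖ ≤ ‖b‖ * ‖x‖ := by
  refine ContinuousLinearMap.opNorm_le_bound _ (by positivity) fun y => ?_
  rw [tensor_apply, norm_smul]
  calc ‖(inner ℝ y x : ℝ)‖ * ‖b‖ ≤ ‖y‖ * ‖x‖ * ‖b‖ := by
        gcongr; exact norm_inner_le_norm _ _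
    _ = _ := by ring

theorem continuous_tensor (b : Vec m) : Continuous fun x : Vec d => tensor b x :=
  (InnerProductSpace.rankOne ℝ b).continuous

theorem hasFDerivAt_piecewiseAffine_of_pos {x : Vec d} (hx : 0 < (inner ℝ x n : ℝ)) :
    HasFDerivAt (piecewiseAffine Gp Gm n) Gp x := by
  refine Gp.hasFDerivAt.congr_of_eventuallyEq ?_
  have hc : Continuous fun y : Vec d => (inner ℝ y n : ℝ) := by fun_prop
  filter_upwards [(hc.tendsto x).eventually_const_lt hx] with y hy
  rw [piecewiseAffine, if_pos hy]

theorem hasFDerivAt_piecewiseAffine_of_neg {x : Vec d} (hx : (inner ℝ x n : ℝ) < 0) :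
    HasFDerivAt (piecewiseAffine Gp Gm n) Gm x := by
  refine Gm.hasFDerivAt.congr_of_eventuallyEq ?_
  have hc : Continuous fun y : Vec d => (inner ℝ y n : ℝ) := by fun_prop
  filter_upwards [(hc.tendsto x).eventually_lt_const hx] with y hy
  rw [piecewiseAffine, if_neg hy.not_gt]

theorem setIntegral_comp_isometry (e : Vec d ≃ₗᵢ[ℝ] Vec d) (f : Vec d → ℝ) :
    ∫ x in ball (0 : Vec d) 1, f (e x) = ∫ x in ball (0 : Vec d) 1, f x := by
  have h := e.measurePreserving.setIntegral_preimage_emb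
    e.toHomeomorph.measurableEmbedding f (ball 0 1)
  have hpre : e ⁻¹' ball 0 1 = ball (0 : Vec d) 1 := by ext x; simp
  rwa [hpre] at h

theorem integrableOn_comp_isometry (e : Vec d ≃ₗᵢ[ℝ] Vec d) {f : Vec d → ℝ}
    (hf : IntegrableOn f (ball 0 1)) : IntegrableOn (fun x => f (e x)) (ball (0 : Vec d) 1) := by
  have h := (e.measurePreserving.integrableOn_comp_preimage
    e.toHomeomorph.measurableEmbedding (f := f) (s := ball 0 1)).2 hf
  have hpre : e ⁻¹' ball 0 1 = ball (0 : Vec d) 1 := by ext x; simp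
  rwa [hpre] at h

theorem reflection_unit_apply (hn : ‖n‖ = 1) (x : Vec d) :
    (Submodule.span ℝ {n}).reflection x = (2 * inner ℝ x n : ℝ) • n - x := by
  rw [Submodule.reflection_apply, Submodule.starProjection_unit_singleton ℝ hn,
    real_inner_comm, two_smul, two_mul, add_smul]

/-- The first variation of the energy at the broken affine map in the direction
`(1 - |x|²) a`, up to a factor. -/
def tractionDensity (P Q : Mat d m →L[ℝ] ℝ) (a : Vec m) (n x : Vec d) : ℝ :=
  if 0 < (inner ℝ x n : ℝ) then P (tensor a x) else Q (tensor a x)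

theorem integrableOn_tractionDensity (P Q : Mat d m →L[ℝ] ℝ) (a : Vec m) (n : Vec d) :
    IntegrableOn (tractionDensity P Q a n) (ball 0 1) := by
  have hm : Measurable (tractionDensity P Q a n) := by
    refine Measurable.ite (measurableSet_lt measurable_const ?_) ?_ ?_
    · have hc : Continuous fun y : Vec d => (inner ℝ y n : ℝ) := by fun_prop
      exact hc.measurable
    · exact (P.continuous.comp (continuous_tensor a)).measurable
    · exact (Q.continuous.comp (continuous_tensor a)).measurable
  refine integrableOn_of_bound hm (C := max (‖P‖ * ‖a‖) (‖Q‖ * ‖a‖)) (fun x hx => ?_)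
    measure_ball_lt_top.ne measurableSet_ball
  have hx1 : ‖x‖ ≤ 1 := by
    have : ‖x‖ < 1 := by simpa using hx
    exact this.le
  have key : ∀ S : Mat d m →L[ℝ] ℝ, |S (tensor a x)| ≤ ‖S‖ * ‖a‖ := fun S => by
    refine (S.le_opNorm _).trans ?_
    gcongr
    exact (norm_tensor_le a x).trans (by nlinarith [norm_nonneg a])
  rw [tractionDensity]
  split_ifs
  · exact (key P).trans (le_max_left _ _)
  · exact (key Q).trans (le_max_right _ _)

/-- Average over the group generated by x ↦ −x and the reflection ρx = 2(x · n)n − x in the line of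
n. Since ρ keeps the sign of x · n, x + ρx removes the tangential part; the antipodes exchange P and
Q with a change of sign. This replaces integration by parts across the interface. -/
theorem setIntegral_tractionDensity (P Q : Mat d m →L[ℝ] ℝ) (hn : ‖n‖ = 1) :
    4 * ∫ x in ball (0 : Vec d) 1, tractionDensity P Q a n x =
      2 * (P - Q) (tensor a n) * ∫ x in ball (0 : Vec d) 1, |(inner ℝ x n : ℝ)| := by
  set D := tractionDensity P Q a n
  have hD := integrableOn_tractionDensity P Q a n
  set ρ := (Submodule.span ℝ {n}).reflection
  set ν : Vec d ≃ₗᵢ[ℝ] Vec d := LinearIsometryEquiv.neg ℝ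
  have h1 := setIntegral_comp_isometry ν D
  have h2 := setIntegral_comp_isometry ρ D
  have h3 := setIntegral_comp_isometry ρ fun x => D (ν x)
  have i1 := integrableOn_comp_isometry ν hD
  have i2 := integrableOn_comp_isometry ρ hD
  have i3 := integrableOn_comp_isometry ρ i1
  have hpt : ∀ᵐ x : Vec d, (D x + D (ν x)) + (D (ρ x) + D (ν (ρ x))) =
      2 * (P - Q) (tensor a n) * |(inner ℝ x n : ℝ)| := by
    filter_upwards [ae_inner_ne hn 0] with x hx
    have hnn : inner ℝ n n = (1 : ℝ) := by rw [real_inner_self_eq_norm_sq, hn, one_pow]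
    have hρ : (inner ℝ (ρ x) n : ℝ) = inner ℝ x n := by
      rw [reflection_unit_apply hn, inner_sub_left, real_inner_smul_left, hnn]; ring
    have hneg : ∀ y : Vec d, tensor a (-y) = -tensor a y := fun y => by
      simp [tensor]
    have hten : tensor a (ρ x) = (2 * inner ℝ x n : ℝ) • tensor a n - tensor a x := by
      rw [reflection_unit_apply hn]
      simp [tensor]
    simp only [D, ν, tractionDensity, LinearIsometryEquiv.coe_neg, inner_neg_left, hρ, hneg, hten,
      sub_apply, map_neg, map_sub, map_smul, smul_eq_mul]
    rcases lt_or_gt_of_ne hx with h | h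
    · rw [if_neg h.not_gt, if_pos (by linarith), if_neg h.not_gt, if_pos (by linarith),
        abs_of_neg h]
      ring
    · rw [if_pos h, if_neg (by linarith), if_pos h, if_neg (by linarith), abs_of_pos h]
      ring
  have h4 := integral_congr_ae (ae_restrict_of_ae (s := ball (0 : Vec d) 1) hpt)
  have i4 : IntegrableOn (fun x => D x + D (ν x)) (ball 0 1) := hD.add i1
  have i5 : IntegrableOn (fun x => D (ρ x) + D (ν (ρ x))) (ball 0 1) := i2.add i3
  rw [integral_add i4 i5, integral_add hD i1, integral_add i2 i3, integral_const_mul] at h4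
  linarith

theorem setIntegral_abs_inner_pos (hn : ‖n‖ = 1) :
    0 < ∫ x in ball (0 : Vec d) 1, |(inner ℝ x n : ℝ)| := by
  have hc : Continuous fun x : Vec d => |(inner ℝ x n : ℝ)| := by fun_prop
  have hi : IntegrableOn (fun x : Vec d => |(inner ℝ x n : ℝ)|) (ball 0 1) :=
    (hc.continuousOn.integrableOn_compact (isCompact_closedBall (0 : Vec d) 1)).mono_set
      ball_subset_closedBall
  rw [setIntegral_pos_iff_support_of_nonneg_ae (Eventually.of_forall fun x => abs_nonneg _) hi]
  have h0 : volume (ball (0 : Vec d) 1 \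
      Function.support fun x : Vec d => |(inner ℝ x n : ℝ)|) = 0 := by
    refine measure_mono_null ?_ (ae_iff.1 (ae_inner_ne hn 0))
    intro x hx
    simpa using hx.2
  have h1 := measure_ball_pos (volume : Measure (Vec d)) 0 one_pos
  by_contra h
  have h2 : volume ((Function.support fun x : Vec d => |(inner ℝ x n : ℝ)|) ∩
      ball (0 : Vec d) 1) = 0 := by simpa using h
  refine h1.ne' (measure_mono_null (fun x hx => ?_) (measure_union_null h2 h0))
  by_cases hs : x ∈ Function.support fun x : Vec d => |(inner ℝ x n : ℝ)|
  · exact Or.inl ⟨hs, hx⟩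
  · exact Or.inr ⟨hx, hs⟩

/-- Interchange stability is necessary, by the Euler–Lagrange equation across the interface. -/
theorem IsStableUnderVariations.interchange_le {W : Mat d m → ℝ} (hW : Continuous W)
    (hn : ‖n‖ = 1) (hK : Gp - Gm = tensor a n) (hs : IsStableUnderVariations W Gp Gm n)
    {P Q : Mat d m →L[ℝ] ℝ} (hP : HasFDerivAt W P Gp) (hQ : HasFDerivAt W Q Gm) :
    (P - Q) (tensor a n) ≤ 0 := by
  set V := volume.real (ball (0 : Vec d) 1) with hV
  have hV0 : 0 < V := volume_real_ball_pos _ one_pos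
  have hD := integrableOn_tractionDensity P Q a n
  have hle : ∫ x in ball (0 : Vec d) 1, tractionDensity P Q a n x ≤ 0 := by
    refine le_of_forall_pos_le_add fun δ hδ => ?_
    -- The accumulated Taylor error, divided by 2t, is ε‖a‖V ≤ δ; the added 1 covers a = 0.
    set ε := δ / (‖a‖ * V + 1) with hε
    have hε0 : 0 < ε := by positivity
    have hexp : ∀ {G : Mat d m} {S : Mat d m →L[ℝ] ℝ}, HasFDerivAt W S G →
        ∃ ρ > 0, ∀ H : Mat d m, ‖H‖ < ρ → W (G + H) ≤ W G + S H + ε * ‖H‖ := by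
      intro G S hS
      obtain ⟨ρ, hρ, h⟩ := Metric.eventually_nhds_iff.1 (hS.isLittleO.bound hε0)
      refine ⟨ρ, hρ, fun H hH => ?_⟩
      have := h (y := G + H) (by simpa [dist_eq_norm] using hH)
      rw [add_sub_cancel_left] at this
      have := (le_abs_self _).trans this
      linarith
    obtain ⟨ρ₁, hρ₁, h₁⟩ := hexp hP
    obtain ⟨ρ₂, hρ₂, h₂⟩ := hexp hQ
    -- On the unit ball the perturbation t(1 − |x|²)a has gradient −2t a ⊗ x, of norm at most 2t‖a‖.
    -- Only t > 0 is needed, since only an inequality is wanted.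
    obtain ⟨t, ht0, ht₁, ht₂⟩ : ∃ t : ℝ, 0 < t ∧ 2 * t * ‖a‖ < ρ₁ ∧ 2 * t * ‖a‖ < ρ₂ := by
      have hc : Continuous fun t : ℝ => 2 * t * ‖a‖ := by fun_prop
      have e1 : ∀ᶠ t in 𝓝[>] (0 : ℝ), 2 * t * ‖a‖ < ρ₁ :=
        ((hc.tendsto 0).eventually_lt_const (by simpa using hρ₁)).filter_mono nhdsWithin_le_nhds
      have e2 : ∀ᶠ t in 𝓝[>] (0 : ℝ), 2 * t * ‖a‖ < ρ₂ :=
        ((hc.tendsto 0).eventually_lt_const (by simpa using hρ₂)).filter_mono nhdsWithin_le_nhds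
      obtain ⟨t, h1, h2, h3⟩ := (e1.and (e2.and self_mem_nhdsWithin)).exists
      exact ⟨t, h3, h1, h2⟩
    have hφ := isVariation_paraboloid (d := d) (t • a)
    have h := hs _ hφ
    have hL := lipschitz_piecewiseAffine hn hK
    have hWb := isBoundedOnBounded_of_continuous hW
    have i1 := integrableOn_ball_comp_fderiv hW.measurable hWb hL 0 1
    have i2 := integrableOn_ball_comp_fderiv hW.measurable hWb (hφ.lipschitz_add hL) 0 1
    have hpt : ∀ᵐ x : Vec d, x ∈ ball (0 : Vec d) 1 →
        W (fderiv ℝ (fun x => piecewiseAffine Gp Gm n x + paraboloid x • t • a) x) ≤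
          W (fderiv ℝ (piecewiseAffine Gp Gm n) x) + ((-2 * t) * tractionDensity P Q a n x +
            ε * (2 * t * ‖a‖)) := by
      filter_upwards [ae_inner_ne hn 0] with x hx hxB
      have hx1 : ‖x‖ < 1 := by simpa using hxB
      have hpar := hasFDerivAt_paraboloid (t • a) hxB
      have hH : (-2 : ℝ) • tensor (t • a) x = (-2 * t) • tensor a x := by
        ext1 y
        simp [tensor_apply, smul_smul]
        ring_nf
      rw [hH] at hpar
      have hnorm : ‖(-2 * t) • tensor a x‖ ≤ 2 * t * ‖a‖ := by
        rw [norm_smul, norm_mul, norm_neg, Real.norm_of_nonneg zero_le_two,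
          Real.norm_of_nonneg ht0.le]
        gcongr
        exact (norm_tensor_le a x).trans (by nlinarith [norm_nonneg a])
      have hnorm' := mul_le_mul_of_nonneg_left hnorm hε0.le
      rcases lt_or_gt_of_ne hx with h | h
      · have hd := hasFDerivAt_piecewiseAffine_of_neg (Gp := Gp) (Gm := Gm) h
        rw [(hd.fun_add hpar).fderiv, hd.fderiv, tractionDensity, if_neg h.not_gt]
        have := h₂ _ (hnorm.trans_lt ht₂)
        rw [map_smul, smul_eq_mul] at this
        linarith
      · have hd := hasFDerivAt_piecewiseAffine_of_pos (Gp := Gp) (Gm := Gm) h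
        rw [(hd.fun_add hpar).fderiv, hd.fderiv, tractionDensity, if_pos h]
        have := h₁ _ (hnorm.trans_lt ht₁)
        rw [map_smul, smul_eq_mul] at this
        linarith
    have hi : IntegrableOn (fun x => (-2 * t) * tractionDensity P Q a n x +
        ε * (2 * t * ‖a‖)) (ball (0 : Vec d) 1) :=
      (hD.const_mul _).add (integrableOn_const measure_ball_lt_top.ne)
    have hint := setIntegral_mono_on_ae i2 (i1.add hi) measurableSet_ball hpt
    rw [integral_add' i1 hi, integral_add (hD.const_mul _)
      (integrableOn_const measure_ball_lt_top.ne), integral_const_mul, setIntegral_const,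
      smul_eq_mul] at hint
    set I := ∫ x in ball (0 : Vec d) 1, tractionDensity P Q a n x
    have h5 : t * I ≤ t * (ε * (‖a‖ * V)) := by
      rw [← hV] at hint
      linarith
    have h6 := le_of_mul_le_mul_left h5 ht0
    have h7 : ε * (‖a‖ * V) ≤ δ := by
      rw [hε, div_mul_eq_mul_div, div_le_iff₀ (by positivity)]
      nlinarith [norm_nonneg a]
    linarith
  have h8 := setIntegral_tractionDensity (a := a) P Q hn
  have h9 := setIntegral_abs_inner_pos hn
  by_contra hcon
  have := mul_pos (not_le.1 hcon) h9
  linarith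

/-! ### The interchange force in terms of Fréchet derivatives. -/

theorem entry_matUnit (i k : Fin m) (j l : Fin d) :
    entry (matUnit i j) k l = if k = i ∧ l = j then (1 : ℝ) else 0 := by
  rw [entry, matUnit, tensor_apply]
  by_cases h1 : k = i <;> by_cases h2 : l = j <;>
    simp [h1, h2, EuclideanSpace.inner_single_left]

theorem sum_entry_smul_matUnit (X : Mat d m) : ∑ i, ∑ j, entry X i j • matUnit i j = X := by
  refine ContinuousLinearMap.coe_injective
    ((EuclideanSpace.basisFun (Fin d) ℝ).toBasis.ext fun l => ?_)
  ext k
  simp only [OrthonormalBasis.coe_toBasis, EuclideanSpace.basisFun_apply,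
    ContinuousLinearMap.coe_coe]
  change entry (∑ i, ∑ j, entry X i j • matUnit i j) k l = entry X k l
  have hadd : ∀ {ι : Type} (s : Finset ι) (f : ι → Mat d m),
      entry (∑ i ∈ s, f i) k l = ∑ i ∈ s, entry (f i) k l := fun s f => by
    simp [entry]
  have hsm : ∀ (c : ℝ) (Y : Mat d m), entry (c • Y) k l = c * entry Y k l := fun c Y => by
    simp [entry]
  simp only [hadd, hsm, entry_matUnit, ite_and]
  simp

theorem frobeniusInner_matGrad (W : Mat d m → ℝ) (F X : Mat d m) :
    frobeniusInner (matGrad W F) X = fderiv ℝ W F X := by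
  have he : ∀ k l, entry (matGrad W F) k l = fderiv ℝ W F (matUnit k l) := by
    intro k l
    have hadd : ∀ {ι : Type} (s : Finset ι) (f : ι → Mat d m),
        entry (∑ i ∈ s, f i) k l = ∑ i ∈ s, entry (f i) k l := fun s f => by
      simp [entry]
    have hsm : ∀ (c : ℝ) (Y : Mat d m), entry (c • Y) k l = c * entry Y k l := fun c Y => by
      simp [entry]
    rw [matGrad]
    simp only [hadd, hsm, entry_matUnit, ite_and]
    simp
  conv_rhs => rw [← sum_entry_smul_matUnit X]
  simp only [frobeniusInner, he, map_sum, map_smul, smul_eq_mul, mul_comm]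

theorem interchangeForce_eq (W : Mat d m → ℝ) (hK : Gp - Gm = tensor a n) :
    interchangeForce W Gp Gm = (fderiv ℝ W Gp - fderiv ℝ W Gm) (tensor a n) := by
  have hsub : ∀ A B X : Mat d m,
      frobeniusInner (A - B) X = frobeniusInner A X - frobeniusInner B X := fun A B X => by
    simp [frobeniusInner, entry, sub_mul, Finset.sum_sub_distrib]
  rw [interchangeForce, hsub, frobeniusInner_matGrad, frobeniusInner_matGrad, hK, sub_apply]

/-! ### Half-ball averages and the energy on the ball. -/

theorem measurableSet_halfBallPos (n : Vec d) : MeasurableSet (halfBallPos n) := by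
  have hc : Continuous fun y : Vec d => (inner ℝ y n : ℝ) := by fun_prop
  exact measurableSet_ball.inter (measurableSet_lt measurable_const hc.measurable)

theorem measurableSet_halfBallNeg (n : Vec d) : MeasurableSet (halfBallNeg n) := by
  have hc : Continuous fun y : Vec d => (inner ℝ y n : ℝ) := by fun_prop
  exact measurableSet_ball.inter (measurableSet_lt hc.measurable measurable_const)

theorem setIntegral_ball_eq_add {f : Vec d → ℝ} (hn : ‖n‖ = 1)
    (hf : IntegrableOn f (ball (0 : Vec d) 1)) :
    ∫ x in ball (0 : Vec d) 1, f x = (∫ x in halfBallPos n, f x) + ∫ x in halfBallNeg n, f x := by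
  rw [← setIntegral_union (disjoint_left.2 fun x hx hx' => lt_asymm hx.2 hx'.2)
    (measurableSet_halfBallNeg n) (hf.mono_set fun x hx => hx.1) (hf.mono_set fun x hx => hx.1)]
  refine setIntegral_congr_set ?_
  filter_upwards [ae_inner_ne hn 0] with x hx
  refine propext ⟨fun h => ?_, fun h => h.elim (fun h => h.1) fun h => h.1⟩
  rcases lt_or_gt_of_ne hx with h' | h'
  · exact Or.inr ⟨h, h'⟩
  · exact Or.inl ⟨h, h'⟩

theorem volume_real_halfBall (hn : ‖n‖ = 1) :
    volume.real (halfBallPos n) = volume.real (ball (0 : Vec d) 1) / 2 ∧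
      volume.real (halfBallNeg n) = volume.real (ball (0 : Vec d) 1) / 2 := by
  have h1 := setIntegral_ball_eq_add (f := fun _ => (1 : ℝ)) hn
    (integrableOn_const measure_ball_lt_top.ne)
  simp only [setIntegral_const, smul_eq_mul, mul_one] at h1
  have h2 : volume (halfBallNeg n) = volume (halfBallPos n) := by
    rw [← Measure.measure_preimage_neg volume (halfBallPos n)]
    congr 1
    ext x
    simp [halfBallPos, halfBallNeg, unitBall]
  have h3 : volume.real (halfBallNeg n) = volume.real (halfBallPos n) := by
    rw [Measure.real, h2, Measure.real]
  constructor <;> linarith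

/-- The sum of the two half-ball averages in terms of the energy on the ball. -/
theorem average_add_average_eq {W : Mat d m → ℝ} (hW : Continuous W) (hn : ‖n‖ = 1)
    (hK : Gp - Gm = tensor a n) {φ : Vec d → Vec m} (hφ : IsVariation (ball 0 1) φ) :
    ((⨍ z in halfBallPos n, W (Gp + fderiv ℝ φ z)) +
      ⨍ z in halfBallNeg n, W (Gm + fderiv ℝ φ z)) =
      2 / volume.real (ball (0 : Vec d) 1) *
        ∫ x in ball (0 : Vec d) 1,
          W (fderiv ℝ (fun x => piecewiseAffine Gp Gm n x + φ x) x) := by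
  obtain ⟨hp, hm⟩ := volume_real_halfBall hn
  have hL := hφ.lipschitz_add (lipschitz_piecewiseAffine hn hK)
  obtain ⟨K, hKφ⟩ := hφ.1
  have e1 : ∫ x in halfBallPos n, W (fderiv ℝ (fun x => piecewiseAffine Gp Gm n x + φ x) x) =
      ∫ x in halfBallPos n, W (Gp + fderiv ℝ φ x) := by
    refine setIntegral_congr_ae (measurableSet_halfBallPos n) ?_
    filter_upwards [hKφ.ae_differentiableAt (μ := volume)] with x hx hxB
    rw [((hasFDerivAt_piecewiseAffine_of_pos hxB.2).fun_add hx.hasFDerivAt).fderiv]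
  have e2 : ∫ x in halfBallNeg n, W (fderiv ℝ (fun x => piecewiseAffine Gp Gm n x + φ x) x) =
      ∫ x in halfBallNeg n, W (Gm + fderiv ℝ φ x) := by
    refine setIntegral_congr_ae (measurableSet_halfBallNeg n) ?_
    filter_upwards [hKφ.ae_differentiableAt (μ := volume)] with x hx hxB
    rw [((hasFDerivAt_piecewiseAffine_of_neg hxB.2).fun_add hx.hasFDerivAt).fderiv]
  rw [setIntegral_ball_eq_add hn (integrableOn_ball_comp_fderiv hW.measurable
    (isBoundedOnBounded_of_continuous hW) hL 0 1), e1, e2, setAverage_eq, setAverage_eq, hp, hm,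
    smul_eq_mul, smul_eq_mul, inv_div]
  ring

theorem IsTestFunction.isVariation {φ : Vec d → Vec m} (hφ : IsTestFunction φ) :
    IsVariation (ball 0 1) φ := by
  have hc : HasCompactSupport φ :=
    HasCompactSupport.of_support_subset_isCompact (isCompact_closedBall (0 : Vec d) 1)
      ((subset_tsupport φ).trans (hφ.2.trans ball_subset_closedBall))
  refine ⟨ContDiff.lipschitzWith_of_hasCompactSupport hc hφ.1 (by simp), fun z hz => ?_⟩
  exact image_eq_zero_of_notMem_tsupport fun h => hz (hφ.2 h)

theorem isStronglyLocallyStable_iff {W : Mat d m → ℝ} (hW : Continuous W) (hn : ‖n‖ = 1)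
    (hK : Gp - Gm = tensor a n) :
    IsStronglyLocallyStable W Gp Gm n ↔ ∀ φ : Vec d → Vec m, IsTestFunction φ →
      ∫ x in ball (0 : Vec d) 1, W (fderiv ℝ (piecewiseAffine Gp Gm n) x) ≤
        ∫ x in ball (0 : Vec d) 1,
          W (fderiv ℝ (fun x => piecewiseAffine Gp Gm n x + φ x) x) := by
  refine forall₂_congr fun φ hφ => ?_
  rw [average_add_average_eq hW hn hK hφ.isVariation,
    setIntegral_piecewiseAffine hW.measurable (isBoundedOnBounded_of_continuous hW) hn hK,
    div_mul_eq_mul_div, le_div_iff₀ (volume_real_ball_pos (0 : Vec d) one_pos)]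
  constructor <;> intro h <;> linarith

/-! ### Mollification: from smooth to Lipschitz variations. -/

section Mollification

open scoped Convolution

variable {φ : Vec d → Vec m} {K : NNReal}

/-- Mollification of `φ`. -/
def mollify (ρ : ContDiffBump (0 : Vec d)) (φ : Vec d → Vec m) : Vec d → Vec m :=
  ρ.normed volume ⋆[ContinuousLinearMap.lsmul ℝ ℝ, volume] φ

/-- The derivative is put on φ rather than on the kernel, by Rademacher's theorem and domination by
the Lipschitz constant. Gradients of mollifications are thus averages of ∇φ: they keep the bound K
and converge almost everywhere. -/
theorem hasFDerivAt_mollify (hφ : LipschitzWith K φ) (ρ : ContDiffBump (0 : Vec d)) (x : Vec d) :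
    HasFDerivAt (mollify ρ φ)
      ((ρ.normed volume ⋆[ContinuousLinearMap.lsmul ℝ ℝ, volume] fderiv ℝ φ) x) x := by
  have hρc : Continuous (ρ.normed (volume : Measure (Vec d))) := ρ.continuous_normed
  have hρi : Integrable (ρ.normed (volume : Measure (Vec d))) volume := ρ.integrable_normed
  refine (hasFDerivAt_integral_of_dominated_loc_of_lip (μ := (volume : Measure (Vec d)))
    (F := fun x t => ρ.normed volume t • φ (x - t))
    (F' := fun t => ρ.normed volume t • fderiv ℝ φ (x - t))
    (bound := fun t => ρ.normed volume t * K) (s := univ) univ_mem ?_ ?_ ?_ ?_ ?_ ?_).2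
  · exact Eventually.of_forall fun y =>
      (hρc.smul (hφ.continuous.comp (continuous_const.sub continuous_id))).aestronglyMeasurable
  · exact (hρc.smul (hφ.continuous.comp (continuous_const.sub continuous_id))
      ).integrable_of_hasCompactSupport ρ.hasCompactSupport_normed.smul_right
  · exact (hρc.measurable.smul ((measurable_fderiv ℝ φ).comp
      (measurable_const.sub measurable_id))).aestronglyMeasurable
  · refine Eventually.of_forall fun t => LipschitzWith.lipschitzOnWith ?_
    refine LipschitzWith.of_dist_le_mul fun y z => ?_
    have h0 : 0 ≤ ρ.normed volume t := ρ.nonneg_normed t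
    have := hφ.dist_le_mul (y - t) (z - t)
    rw [dist_sub_right] at this
    rw [dist_smul₀, Real.norm_of_nonneg h0, Real.coe_nnabs, abs_of_nonneg (by positivity), mul_assoc]
    gcongr
  · exact hρi.mul_const _
  · have h1 := (Measure.measurePreserving_sub_left (volume : Measure (Vec d)) x
      ).quasiMeasurePreserving.ae (hφ.ae_differentiableAt (μ := volume))
    filter_upwards [h1] with t ht
    exact ((hasFDerivAt_comp_sub t).2 ht.hasFDerivAt).fun_const_smul _

theorem norm_fderiv_mollify_le (hφ : LipschitzWith K φ) (ρ : ContDiffBump (0 : Vec d))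
    (x : Vec d) : ‖fderiv ℝ (mollify ρ φ) x‖ ≤ K := by
  rw [(hasFDerivAt_mollify hφ ρ x).fderiv, convolution_def]
  have h1 : ∫ t, ρ.normed volume t * K = (K : ℝ) := by
    rw [integral_mul_const, ρ.integral_normed, one_mul]
  rw [← h1]
  refine norm_integral_le_of_norm_le (ρ.integrable_normed.mul_const _)
    (Eventually.of_forall fun t => ?_)
  have h0 : 0 ≤ ρ.normed volume t := ρ.nonneg_normed t
  rw [ContinuousLinearMap.lsmul_apply, norm_smul, Real.norm_of_nonneg h0]
  gcongr
  exact norm_fderiv_le_of_lipschitz ℝ hφ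

theorem isTestFunction_mollify (hφ : LipschitzWith K φ) {s : ℝ}
    (h0 : ∀ z ∉ ball (0 : Vec d) s, φ z = 0) {ρ : ContDiffBump (0 : Vec d)}
    (hρ : s + ρ.rOut < 1) : IsTestFunction (mollify ρ φ) := by
  refine ⟨?_, ?_⟩
  · exact HasCompactSupport.contDiff_convolution_left _ ρ.hasCompactSupport_normed
      ρ.contDiff_normed hφ.continuous.locallyIntegrable
  · have h1 : tsupport (mollify ρ φ) ⊆ closedBall 0 (s + ρ.rOut) := by
      refine closure_minimal ?_ isClosed_closedBall
      refine (support_convolution_subset _).trans ?_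
      rintro _ ⟨x, hx, y, hy, rfl⟩
      rw [ρ.support_normed_eq] at hx
      have hy' : y ∈ ball (0 : Vec d) s := by
        by_contra h
        exact hy (h0 y h)
      have hx1 : ‖x‖ < ρ.rOut := by simpa using hx
      have hy1 : ‖y‖ < s := by simpa using hy'
      have := norm_add_le x y
      simp only [mem_closedBall, dist_zero_right]
      linarith
    exact h1.trans (closedBall_subset_ball hρ)

end Mollification

/-- Stability under smooth variations implies stability under Lipschitz variations with support
in a smaller ball. -/
theorem le_integral_of_le_testFunction {W : Mat d m → ℝ} (hW : Continuous W) (hn : ‖n‖ = 1)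
    (hK : Gp - Gm = tensor a n) {E : ℝ}
    (h : ∀ φ : Vec d → Vec m, IsTestFunction φ →
      E ≤ ∫ x in ball (0 : Vec d) 1, W (fderiv ℝ (fun x => piecewiseAffine Gp Gm n x + φ x) x))
    {φ : Vec d → Vec m} (hφ : IsVariation (ball 0 (1 / 2)) φ) :
    E ≤ ∫ x in ball (0 : Vec d) 1,
      W (fderiv ℝ (fun x => piecewiseAffine Gp Gm n x + φ x) x) := by
  obtain ⟨⟨K, hKφ⟩, h0⟩ := hφ
  obtain ⟨M, hM⟩ := lipschitz_piecewiseAffine hn hK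
  let ρ : ℕ → ContDiffBump (0 : Vec d) := fun k =>
    -- Outer radius at most 1/4 keeps supports within radius 3/4 < 1; the fixed ratio 2 of outer to
    -- inner radius is what convergence at Lebesgue points requires.
    ⟨1 / (8 * (k + 1)), 1 / (4 * (k + 1)), by positivity, by gcongr; norm_num⟩
  have hρ0 : Tendsto (fun k => (ρ k).rOut) atTop (𝓝 0) := by
    have h1 := (tendsto_one_div_add_atTop_nhds_zero_nat (𝕜 := ℝ)).const_mul (1 / 4)
    rw [mul_zero] at h1
    refine h1.congr fun k => ?_
    simp only [ρ]
    field_simp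
  have hρt : ∀ k, IsTestFunction (mollify (ρ k) φ) := fun k =>
    isTestFunction_mollify hKφ h0 (by
      simp only [ρ]
      have : 1 / (4 * ((k : ℝ) + 1)) ≤ 1 / 4 := by
        gcongr
        have : (0 : ℝ) ≤ k := k.cast_nonneg
        linarith
      linarith)
  have hloc : LocallyIntegrable (fderiv ℝ φ) volume := fun x =>
    ⟨ball x 1, ball_mem_nhds _ one_pos, (measurable_fderiv ℝ φ).aestronglyMeasurable,
      HasFiniteIntegral.restrict_of_bounded K measure_ball_lt_top
        (Eventually.of_forall fun y => norm_fderiv_le_of_lipschitz ℝ hKφ)⟩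
  have hconv := ContDiffBump.ae_convolution_tendsto_right_of_locallyIntegrable
    (μ := (volume : Measure (Vec d))) (φ := ρ) (l := atTop) (K := 2) hρ0
    (Eventually.of_forall fun k => by simp only [ρ]; apply le_of_eq; field_simp; norm_num) hloc
  obtain ⟨C, hC⟩ := isBoundedOnBounded_of_continuous hW (M + K)
  have hlim : Tendsto (fun k => ∫ x in ball (0 : Vec d) 1,
      W (fderiv ℝ (fun x => piecewiseAffine Gp Gm n x + mollify (ρ k) φ x) x)) atTop
      (𝓝 (∫ x in ball (0 : Vec d) 1,
        W (fderiv ℝ (fun x => piecewiseAffine Gp Gm n x + φ x) x))) := by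
    have hdiff := hM.ae_differentiableAt (μ := (volume : Measure (Vec d)))
    refine tendsto_integral_of_dominated_convergence (fun _ => C)
      (fun k => (measurable_comp_fderiv hW.measurable _).aestronglyMeasurable)
      (integrableOn_const measure_ball_lt_top.ne) (fun k => ?_) ?_
    · filter_upwards [ae_restrict_of_ae hdiff] with x hx
      refine hC _ ?_
      have hd := hasFDerivAt_mollify hKφ (ρ k) x
      rw [fderiv_fun_add hx hd.differentiableAt]
      exact (norm_add_le _ _).trans (add_le_add (norm_fderiv_le_of_lipschitz ℝ hM)
        (norm_fderiv_mollify_le hKφ _ _))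
    · filter_upwards [ae_restrict_of_ae hdiff, ae_restrict_of_ae hconv,
        ae_restrict_of_ae (hKφ.ae_differentiableAt (μ := volume))] with x hx hcx hφx
      rw [fderiv_fun_add hx hφx]
      refine (hW.tendsto _).comp ?_
      have : ∀ k, fderiv ℝ (fun x => piecewiseAffine Gp Gm n x + mollify (ρ k) φ x) x =
          fderiv ℝ (piecewiseAffine Gp Gm n) x + fderiv ℝ (mollify (ρ k) φ) x := fun k =>
        fderiv_fun_add hx (hasFDerivAt_mollify hKφ (ρ k) x).differentiableAt
      simp only [this]
      refine tendsto_const_nhds.add ?_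
      simpa only [(hasFDerivAt_mollify hKφ _ x).fderiv] using hcx
  exact ge_of_tendsto' hlim fun k => h _ (hρt k)

theorem piecewiseAffine_smul {t : ℝ} (ht : 0 < t) (x : Vec d) :
    piecewiseAffine Gp Gm n (t • x) = t • piecewiseAffine Gp Gm n x := by
  simp only [piecewiseAffine, real_inner_smul_left, mul_pos_iff_of_pos_left ht, map_smul]
  split_ifs <;> rfl

/-- Positive homogeneity makes the interface problem invariant under dilation about 0. Shrinking a
variation to radius 1/2 multiplies its energy change by 2^(-d) and leaves room to mollify inside the
unit ball. -/
theorem isStronglyLocallyStable_iff_isStableUnderVariations {W : Mat d m → ℝ} (hW : Continuous W)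
    (hn : ‖n‖ = 1) (hK : Gp - Gm = tensor a n) :
    IsStronglyLocallyStable W Gp Gm n ↔ IsStableUnderVariations W Gp Gm n := by
  rw [isStronglyLocallyStable_iff hW hn hK]
  refine ⟨fun h φ hφ => ?_, fun h φ hφ => h φ hφ.isVariation⟩
  have hw := hφ.rescale 0 one_half_pos
  have h1 := le_integral_of_le_testFunction hW hn hK h hw
  have hsub : ball (0 : Vec d) (1 / 2) ⊆ ball 0 1 := ball_subset_ball (by norm_num)
  have hrep := setIntegral_add_sum_variations hW.measurable (isBoundedOnBounded_of_continuous hW)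
    (lipschitz_piecewiseAffine hn hK) {()} (c := fun _ => 0) (r := fun _ => 1 / 2)
    (fun _ _ => one_half_pos)
    (w := fun _ x => (1 / 2 : ℝ) • φ ((1 / 2 : ℝ)⁻¹ • (x - 0))) (fun _ _ => hw) (by simp)
    (D := ball (0 : Vec d) 1) (fun _ _ => hsub) measurableSet_ball measure_ball_lt_top.ne
  simp only [Finset.sum_singleton] at hrep
  have hscale : ∀ (u : Vec d → Vec m), (fun x => (1 / 2 : ℝ)⁻¹ •
      (piecewiseAffine Gp Gm n (0 + (1 / 2 : ℝ) • x) + (1 / 2 : ℝ) • u x)) =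
      fun x => piecewiseAffine Gp Gm n x + u x := fun u => by
    ext1 x
    rw [zero_add, piecewiseAffine_smul one_half_pos, ← smul_add, inv_smul_smul₀ (by norm_num)]
  have e1 := gradEnergy_rescale W (fun x => piecewiseAffine Gp Gm n x +
    (1 / 2 : ℝ) • φ ((1 / 2 : ℝ)⁻¹ • (x - 0))) 0 one_half_pos
  have e2 := gradEnergy_rescale W (piecewiseAffine Gp Gm n) 0 one_half_pos
  have h3 : ∀ x : Vec d, (1 / 2 : ℝ)⁻¹ • ((0 : Vec d) + (1 / 2 : ℝ) • x - 0) = x := fun x => by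
    rw [zero_add, sub_zero, inv_smul_smul₀ (by norm_num)]
  have h4 := hscale fun _ => 0
  simp only [smul_zero, add_zero] at h4
  simp only [h3] at e1
  rw [hscale φ] at e1
  rw [h4] at e2
  rw [hrep, e1, e2] at h1
  refine le_of_mul_le_mul_left ?_ (pow_pos (one_half_pos (α := ℝ)) d)
  linarith

/-- Material and interchange stability characterize stability under Lipschitz variations. -/
theorem isStableUnderVariations_iff {W : Mat d m → ℝ} (hW : Continuous W)
    (hbd : BddBelow (range W)) (hn : ‖n‖ = 1) (hK : Gp - Gm = tensor a n)
    (hp : DifferentiableAt ℝ W Gp) (hm : DifferentiableAt ℝ W Gm) :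
    IsStableUnderVariations W Gp Gm n ↔
      (quasiconvexEnvelope W Gp = W Gp ∧ quasiconvexEnvelope W Gm = W Gm) ∧
        interchangeForce W Gp Gm ≤ 0 := by
  have : Nontrivial (Vec d) := ⟨n, 0, fun h => by simp [h] at hn⟩
  rw [quasiconvexEnvelope_eq_iff hW hbd, quasiconvexEnvelope_eq_iff hW hbd,
    interchangeForce_eq W hK]
  exact ⟨fun h => ⟨h.isQuasiconvexAt hW hn hK,
      h.interchange_le hW hn hK hp.hasFDerivAt hm.hasFDerivAt⟩,
    fun h φ hφ => energy_piecewiseAffine_le hW hbd hn hK h.1.1 h.1.2 hp.hasFDerivAt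
      hm.hasFDerivAt h.2 hφ⟩

end PhaseInterface

end

theorem theorem1 {d m : ℕ} (W : PhaseInterface.Mat d m → ℝ)
    (Fp Fm : PhaseInterface.Mat d m)
    (a : PhaseInterface.Vec m) (n : PhaseInterface.Vec d)
    (hcont : Continuous W)
    (hbdd : BddBelow (Set.range W))
    (hC2 : ∃ U : Set (PhaseInterface.Mat d m),
      IsOpen U ∧ Fp ∈ U ∧ Fm ∈ U ∧ ContDiffOn ℝ 2 W U)
    (hn : ‖n‖ = 1)
    (hK : Fp - Fm = PhaseInterface.tensor a n) :
    (PhaseInterface.IsStronglyLocallyStable W Fp Fm n ↔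
      (PhaseInterface.quasiconvexEnvelope W Fp = W Fp ∧
        PhaseInterface.quasiconvexEnvelope W Fm = W Fm) ∧
      PhaseInterface.interchangeForce W Fp Fm ≤ 0) ∧
    (PhaseInterface.IsInterfaceMinimizer W Fp Fm n ↔
      (PhaseInterface.quasiconvexEnvelope W Fp = W Fp ∧
        PhaseInterface.quasiconvexEnvelope W Fm = W Fm) ∧
      PhaseInterface.interchangeForce W Fp Fm ≤ 0) := by
  have : Nontrivial (PhaseInterface.Vec d) := ⟨n, 0, fun h => by simp [h] at hn⟩
  obtain ⟨U, hU, hpU, hmU, hWU⟩ := hC2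
  have hdiff : ∀ F ∈ U, DifferentiableAt ℝ W F := fun F hF =>
    (hWU.contDiffAt (hU.mem_nhds hF)).differentiableAt (by norm_num)
  have h := PhaseInterface.isStableUnderVariations_iff hcont hbdd hn hK (hdiff Fp hpU)
    (hdiff Fm hmU)
  exact ⟨(PhaseInterface.isStronglyLocallyStable_iff_isStableUnderVariations hcont hn hK).trans h,
    (PhaseInterface.isInterfaceMinimizer_iff hn hK).trans h⟩
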